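/- **Theorem 2.1.** Let $K$ be an infinite field of characteristic $p>0$, let $n\ge 1$ and $r\ge 0$ be integers, and let $\lambda=(\lambda_1\ge\dots\ge\lambda_n\ge 0)$ and $\mu=(\mu_1\ge\dots\ge\mu_n\ge 0)$ be partitions of $r$ with at most $n$ parts (with $\lambda_2=\mu_2=0$ if $n=1$) such that $\mu_2\le\lambda_1$. Let $k,d$ be nonnegative integers such that $$p^d>\min\{\lambda_2,\ \mu_1-\lambda_1\}.$$ Then $$\dim_K\operatorname{Hom}_S(\Delta(\lambda),\Delta(\mu))=\dim_K\operatorname{Hom}_{S'}(\Delta(\lambda^+),\Delta(\mu^+)),$$ where $S=S_K(n,r)$, $S'=S_K(n,r+kp^d)$, $\lambda^+=(\lambda_1+kp^d,\lambda_2,\dots,\lambda_n)$ and $\mu^+=(\mu_1+kp^d,\mu_2,\dots,\mu_n)$. Here $V=K^n$, and $S_K(n,s)=\operatorname{End}_{K\mathfrak S_s}(V^{\otimes s})$ is the Schur algebra, with the symmetric group $\mathfrak S_s$ acting by place permutations. For a partition $\nu$ of $s$ with at most $n$ parts and with transpose $\nu^t$, $\Delta(\nu)$ is the Weyl module: the image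 of the $S_K(n,s)$-map $d'_\nu: D_{\nu_1}V\otimes\dots\otimes D_{\nu_n}V\to\Lambda^{\nu^t_1}V\otimes\dots\otimes\Lambda^{\nu^t_{\nu_1}}V$ that comultiplies each divided power $D_{\nu_i}V$ into $V^{\otimes\nu_i}$, one factor for each cell of row $i$ of the diagram of $\nu$, and then multiplies the factors in each column in the exterior algebra. -/

import Mathlib

set_option maxSynthPendingDepth 3

noncomputable section

/-! ### Partitions -/

/-- Partitions of `r` with at most `n` parts: weakly decreasing sequences
`(l 0 ≥ l 1 ≥ ... ≥ l (n - 1))` of `n` nonnegative integers with sum `r`. -/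
@[ext]
structure BoundedPartition (n r : ℕ) where
  parts : Fin n → ℕ
  antitone' : Antitone parts
  sum_eq' : ∑ i, parts i = r

namespace BoundedPartition

variable {n r : ℕ}

/-- The part with (zero-based) index `i`; it is `0` beyond the length `n` of the sequence. So
`l.part 0` is the first part and `l.part 1` the second part. -/
def part (l : BoundedPartition n r) (i : ℕ) : ℕ :=
  if h : i < n then l.parts ⟨i, h⟩ else 0

/-- The partition obtained by adding `m` to the first part. -/
def addFirst [NeZero n] (l : BoundedPartition n r) (m : ℕ) : BoundedPartition n (r + m) where
  parts := l.parts + Pi.single 0 m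
  antitone' := by
    intro i j hij
    have h := l.antitone' hij
    by_cases hj : j = 0
    · have hi : i = 0 := by
        subst hj
        exact nonpos_iff_eq_zero.mp hij
      simp [hi, hj]
    · simp only [Pi.add_apply, Pi.single_apply, hj, if_false]
      omega
  sum_eq' := by
    simp [Finset.sum_add_distrib, l.sum_eq', Finset.sum_pi_single']

/-- The cells of the diagram of a partition, row by row: a cell is a pair consisting of a row `i`
and of a column `j < l i`. -/
abbrev Cell (l : BoundedPartition n r) : Type := (i : Fin n) × Fin (l.parts i)

/-- The numbering of the `r` cells by `Fin r`, row by row from top to bottom and from left to right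
in each row. -/
def cell (l : BoundedPartition n r) : Fin r ≃ l.Cell :=
  (finCongr l.sum_eq'.symm).trans finSigmaFinEquiv.symm

/-- The row that contains the cell with number `a`. -/
def row (l : BoundedPartition n r) (a : Fin r) : ℕ := (l.cell a).1

/-- The column that contains the cell with number `a`. -/
def col (l : BoundedPartition n r) (a : Fin r) : ℕ := (l.cell a).2

end BoundedPartition

/-! ### Tensor space and the Schur algebra -/

variable (K : Type*) [Field K] (n r : ℕ)

/-- The tensor space `V ^ ⊗ r`, where `V = K ^ n` is the natural module. -/
abbrev TensorSpace : Type _ := PiTensorProduct K (fun _ : Fin r => (Fin n → K))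

/-- The place permutation of tensor space given by a permutation of the `r` tensor positions. -/
def placePerm (s : Equiv.Perm (Fin r)) : TensorSpace K n r ≃ₗ[K] TensorSpace K n r :=
  PiTensorProduct.reindex K (fun _ : Fin r => (Fin n → K)) s

/-- The Schur algebra `S_K(n, r)`: the algebra of all endomorphisms of `V ^ ⊗ r` that commute with
the place permutations by the symmetric group on `r` letters. -/
def SchurAlgebra : Subalgebra K (Module.End K (TensorSpace K n r)) :=
  Subalgebra.centralizer K
    (Set.range fun s : Equiv.Perm (Fin r) => (placePerm K n r s : Module.End K (TensorSpace K n r)))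

variable {K n r}

theorem placePerm_tprod (s : Equiv.Perm (Fin r)) (v : Fin r → Fin n → K) :
    placePerm K n r s (PiTensorProduct.tprod K v) =
      PiTensorProduct.tprod K (fun a => v (s.symm a)) :=
  PiTensorProduct.reindex_tprod s v

theorem placePerm_smul (x : SchurAlgebra K n r) (s : Equiv.Perm (Fin r)) (t : TensorSpace K n r) :
    placePerm K n r s (x • t) = x • placePerm K n r s t :=
  LinearMap.congr_fun (Subalgebra.mem_centralizer_iff K |>.1 x.2 _ ⟨s, rfl⟩) t

/-! ### Divided powers, exterior powers and Weyl modules -/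

/-- The module `D(l) = D_{l 1} V ⊗ ... ⊗ D_{l n} V` over the Schur algebra. Here the divided power
`D_a V`, the dual of the degree `a` part of the symmetric algebra of the dual of `V`, is realized as
the space of symmetric tensors in `V ^ ⊗ a`, and so `D(l)` consists of the tensors in `V ^ ⊗ r` that
are fixed by all the permutations of the cells of `l` that preserve every row. -/
def DividedPowerModule (l : BoundedPartition n r) :
    Submodule (SchurAlgebra K n r) (TensorSpace K n r) where
  carrier := {t | ∀ s : Equiv.Perm (Fin r), (∀ a, l.row (s a) = l.row a) → placePerm K n r s t = t}
  add_mem' := by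
    intro t u ht hu s hs
    rw [map_add, ht s hs, hu s hs]
  zero_mem' := by
    intro s _
    exact map_zero _
  smul_mem' := by
    intro x t ht s hs
    rw [placePerm_smul, ht s hs]

/-- The `K`-span of the pure tensors that have two equal factors in different cells of the same
column of `l`. -/
def columnRelations (l : BoundedPartition n r) : Submodule K (TensorSpace K n r) :=
  Submodule.span K {t | ∃ (v : Fin r → Fin n → K) (a b : Fin r),
    a ≠ b ∧ l.col a = l.col b ∧ v a = v b ∧ t = PiTensorProduct.tprod K v}

theorem tprod_add_swap_mem_columnRelations (l : BoundedPartition n r) {a b : Fin r} (hab : a ≠ b)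
    (hc : l.col a = l.col b) (v : Fin r → Fin n → K) :
    PiTensorProduct.tprod K v + PiTensorProduct.tprod K (fun c => v (Equiv.swap a b c)) ∈
      columnRelations (K := K) l := by
  have key : ∀ z : Fin n → K, PiTensorProduct.tprod K
      (Function.update (Function.update v a z) b z) ∈ columnRelations (K := K) l := fun z =>
    Submodule.subset_span ⟨_, a, b, hab, hc, by simp [hab], rfl⟩
  have h := Submodule.sub_mem _ (Submodule.sub_mem _ (key (v a + v b)) (key (v a))) (key (v b))
  have e1 : Function.update (Function.update v a (v a)) b (v b) = v := by simp
  have e2 : Function.update (Function.update v a (v b)) b (v a) =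
      fun c => v (Equiv.swap a b c) := by
    funext c
    by_cases hcb : c = b
    · subst hcb
      simp
    · by_cases hca : c = a
      · subst hca
        simp [hab]
      · simp [hcb, hca, Equiv.swap_apply_of_ne_of_ne hca hcb]
  have hx : ∀ y : Fin n → K, Function.update (Function.update v a (v a + v b)) b y =
      Function.update (Function.update v b y) a (v a + v b) := fun y =>
    Function.update_comm hab _ _ _
  have hy : ∀ x y : Fin n → K, Function.update (Function.update v b y) a x =
      Function.update (Function.update v a x) b y := fun x y =>
    Function.update_comm hab.symm _ _ _
  rw [MultilinearMap.map_update_add, hx, hx, MultilinearMap.map_update_add,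
    MultilinearMap.map_update_add, hy, hy, hy, hy, e1, e2] at h
  convert h using 1
  abel

/-- A tensor that is fixed by the transposition of two cells in one column lies in the span of the
column relations. -/
theorem mem_columnRelations_of_swap (l : BoundedPartition n r) {a b : Fin r} (hab : a ≠ b)
    (hc : l.col a = l.col b) (t : TensorSpace K n r)
    (ht : placePerm K n r (Equiv.swap a b) t = t) : t ∈ columnRelations (K := K) l := by
  classical
  set B := Basis.piTensorProduct (fun _ : Fin r => Pi.basisFun K (Fin n)) with hB
  have hperm : ∀ p : Fin r → Fin n,
      placePerm K n r (Equiv.swap a b) (B p) = B (p ∘ Equiv.swap a b) := by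
    intro p
    rw [hB, Basis.piTensorProduct_apply, placePerm_tprod, Basis.piTensorProduct_apply]
    simp
  have hinv : ∀ p : Fin r → Fin n, (p ∘ Equiv.swap a b) ∘ Equiv.swap a b = p := by
    intro p
    funext c
    simp
  have hrepr : ∀ p, B.repr t (p ∘ Equiv.swap a b) = B.repr t p := by
    have hlin : (Finsupp.lapply (R := K) · ∘ₗ B.repr.toLinearMap ∘ₗ
        (placePerm K n r (Equiv.swap a b)).toLinearMap) =
        fun p : Fin r → Fin n => Finsupp.lapply (R := K) (p ∘ Equiv.swap a b) ∘ₗ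
          B.repr.toLinearMap := by
      funext p
      refine B.ext fun q => ?_
      simp only [LinearMap.comp_apply, LinearEquiv.coe_coe, hperm, Module.Basis.repr_self,
        Finsupp.lapply_apply, Finsupp.single_apply]
      congr 1
      refine propext ⟨fun h => ?_, fun h => ?_⟩
      · rw [← h, hinv]
      · rw [h, hinv]
    intro p
    have h := LinearMap.congr_fun (congrFun hlin p) t
    simp only [LinearMap.comp_apply, LinearEquiv.coe_coe, Finsupp.lapply_apply, ht] at h
    exact h.symm
  rw [← Submodule.Quotient.mk_eq_zero, ← Submodule.mkQ_apply, ← B.sum_repr t, map_sum]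
  refine Finset.sum_involution (fun p _ => p ∘ Equiv.swap a b) ?_ ?_ (fun _ _ => Finset.mem_univ _)
    (fun p _ => hinv p)
  · intro p _
    rw [hrepr, map_smul, map_smul, ← smul_add, ← map_add]
    have := (Submodule.Quotient.mk_eq_zero _).2
      (tprod_add_swap_mem_columnRelations l hab hc (fun c => Pi.basisFun K (Fin n) (p c)))
    rw [hB, Basis.piTensorProduct_apply, Basis.piTensorProduct_apply, Submodule.mkQ_apply]
    exact (congrArg _ this).trans (smul_zero _)
  · intro p _ hp hfix
    apply hp
    have hpab : p a = p b := by
      conv_lhs => rw [← hfix]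
      simp
    rw [map_smul, Submodule.mkQ_apply, (Submodule.Quotient.mk_eq_zero _).2, smul_zero]
    rw [hB, Basis.piTensorProduct_apply]
    exact Submodule.subset_span ⟨_, a, b, hab, hc, by simp [hpab], rfl⟩

theorem smul_mem_columnRelations (l : BoundedPartition n r) (x : SchurAlgebra K n r)
    {t : TensorSpace K n r} (ht : t ∈ columnRelations (K := K) l) :
    x • t ∈ columnRelations (K := K) l := by
  induction ht using Submodule.span_induction with
  | mem t ht =>
    obtain ⟨v, a, b, hab, hc, hv, rfl⟩ := ht
    refine mem_columnRelations_of_swap l hab hc _ ?_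
    rw [placePerm_smul, placePerm_tprod]
    congr 2
    funext c
    by_cases hca : c = a
    · subst hca
      simp [hv]
    · by_cases hcb : c = b
      · subst hcb
        simp [hv]
      · simp [Equiv.swap_apply_of_ne_of_ne hca hcb]
  | zero => simp
  | add t u _ _ ht hu =>
    rw [smul_add]
    exact Submodule.add_mem _ ht hu
  | smul c t _ ht =>
    rw [smul_comm]
    exact Submodule.smul_mem _ c ht

/-- The column relations as a submodule over the Schur algebra. -/
def columnSubmodule (l : BoundedPartition n r) :
    Submodule (SchurAlgebra K n r) (TensorSpace K n r) where
  carrier := columnRelations (K := K) l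
  add_mem' := Submodule.add_mem _
  zero_mem' := Submodule.zero_mem _
  smul_mem' := fun x _ ht => smul_mem_columnRelations l x ht

variable (K)

/-- The module `Λ(l') = Λ ^ (l' 1) V ⊗ ... ⊗ Λ ^ (l' q) V` over the Schur algebra, where `l'` is the
transpose of `l`, that is, `l' j` is the length of column `j` of `l`: the quotient of `V ^ ⊗ r` by
the alternating relations in each column. -/
def ColumnExteriorModule (l : BoundedPartition n r) : Type _ :=
  TensorSpace K n r ⧸ columnSubmodule (K := K) l

instance ColumnExteriorModule.instAddCommGroup (l : BoundedPartition n r) :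
    AddCommGroup (ColumnExteriorModule K l) :=
  Submodule.Quotient.addCommGroup (columnSubmodule (K := K) l)

instance ColumnExteriorModule.instModule (l : BoundedPartition n r) :
    Module (SchurAlgebra K n r) (ColumnExteriorModule K l) :=
  Submodule.Quotient.module (columnSubmodule (K := K) l)

/-- The `K`-vector space structure on `Λ(l')`, induced by that of `V ^ ⊗ r`. -/
instance ColumnExteriorModule.instModuleField (l : BoundedPartition n r) :
    Module K (ColumnExteriorModule K l) :=
  Submodule.Quotient.module' (columnSubmodule (K := K) l)

instance ColumnExteriorModule.instIsScalarTower (l : BoundedPartition n r) :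
    IsScalarTower K (SchurAlgebra K n r) (ColumnExteriorModule K l) :=
  ⟨fun c x q => Submodule.Quotient.induction_on _ q fun t =>
    congrArg (Submodule.Quotient.mk (p := columnSubmodule (K := K) l)) (smul_assoc c x t)⟩

/-- The map `d' : D(l) → Λ(l')`: comultiply each `D_{l i} V` into `V ^ ⊗ (l i)` (the inclusion of
the symmetric tensors), so that each cell of `l` carries a factor `V`, and then multiply the factors
in each column in the exterior algebra (the quotient map). -/
def weylMap (l : BoundedPartition n r) :
    DividedPowerModule (K := K) l →ₗ[SchurAlgebra K n r] ColumnExteriorModule K l :=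
  (columnSubmodule (K := K) l).mkQ ∘ₗ (DividedPowerModule (K := K) l).subtype

/-- The Weyl module `Δ(l)` of the Schur algebra: the image of `d' : D(l) → Λ(l')`. -/
def WeylModule (l : BoundedPartition n r) : Type _ := LinearMap.range (weylMap K l)

instance WeylModule.instAddCommGroup (l : BoundedPartition n r) : AddCommGroup (WeylModule K l) :=
  Submodule.addCommGroup (LinearMap.range (weylMap K l))

instance WeylModule.instModule (l : BoundedPartition n r) :
    Module (SchurAlgebra K n r) (WeylModule K l) :=
  Submodule.module (LinearMap.range (weylMap K l))

/-- The `K`-vector space structure on the Weyl module, restricted from `Λ(l')`. -/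
instance WeylModule.instModuleField (l : BoundedPartition n r) : Module K (WeylModule K l) :=
  Submodule.module' (LinearMap.range (weylMap K l))

instance WeylModule.instIsScalarTower (l : BoundedPartition n r) :
    IsScalarTower K (SchurAlgebra K n r) (WeylModule K l) :=
  ⟨fun c x w => Subtype.ext (smul_assoc c x (w : LinearMap.range (weylMap K l)).1)⟩

instance WeylModule.instSMulCommClass (l : BoundedPartition n r) :
    SMulCommClass (SchurAlgebra K n r) K (WeylModule K l) :=
  IsScalarTower.to_smulCommClass'

/-- The `K`-vector space `Hom_S(Δ(l), Δ(m))`, where `S = S_K(n, r)`. -/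
abbrev WeylHom (l m : BoundedPartition n r) : Type _ :=
  WeylModule K l →ₗ[SchurAlgebra K n r] WeylModule K m

end

/-! Over an infinite field the dual of Δ(μ) becomes a space of polynomials in the entries x (i, j)
of a generic n × n matrix: a functional ψ yields the matrix coefficient g ↦ ψ(g v), where v is the
highest weight vector. The polynomials obtained are exactly those of degree μ_j in column j that do
not change when a column is added to the next one (`columnInvariants_eq_map_coeffPoly`), and they
are spanned by products of minors, one minor for each column of the diagram
(`columnInvariants_eq_minorProductSpan`). The hard inclusion is a leading monomial argument: for the
weight i * j of x (i, j), the monomials of maximal weight in an invariant have semistandard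
exponents, and each such monomial leads a product of minors.

Δ(λ) is cyclic, and it maps onto any vector of weight λ in Δ(μ) that is fixed by the simple upper
transvections (`exists_weylHom`). So Hom(Δ(λ), Δ(μ)) is the space of these vectors. Dually it is
`weylHomForms`: the linear forms on the invariants for μ that see only the component of row degrees
λ and are unchanged when a row is added to the preceding one (`range_weylHomPairing`).

Put q = p^d and N = kq. Multiplication by x (0, 0)^N carries invariants for μ to invariants for μ⁺,
and its transpose is the required isomorphism (`rank_weylHomForms_addFirst`), for two reasons.

Every invariant for μ⁺ has the same component of row degrees λ⁺ as some multiple of x (0, 0)^N.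
Indeed, in a product of minors the first μ₂ columns contribute at most μ₂ to the degree in the first
row, and the other columns contribute single entries x (i, 0). If fewer than N of these are x (0,
0), the degree is at most μ₂ + N - 1 < λ₁ + N.

Multiplication also commutes with row additions in the relevant degrees. The only case to check adds
the second row to the first, where Frobenius gives (x (0, 0) + x (1, 0))^N = x (0, 0)^N + x (1, 0)^q
c. The error term has second-row degree at least q, impossible if q > λ₂. Its first-row degree,
after multiplication by an invariant for μ, is at most (k - 1)q + μ₁, too small if q > μ₁ - λ₁. -/

noncomputable section

open MvPolynomial

/-! ### Weight filtrations of polynomial rings -/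

section Weights

variable {σ τ R : Type*} [CommRing R]

/-- The polynomials all of whose monomials have weight at most `k`. -/
def weightLE (R : Type*) [CommRing R] (w : σ → ℤ) (k : ℤ) : Submodule R (MvPolynomial σ R) :=
  restrictSupport R {m | Finsupp.weight w m ≤ k}

theorem mem_weightLE {w : σ → ℤ} {k : ℤ} {f : MvPolynomial σ R} :
    f ∈ weightLE R w k ↔ ∀ m, coeff m f ≠ 0 → Finsupp.weight w m ≤ k := by
  simp only [weightLE, mem_restrictSupport_iff, Set.subset_def, Finset.mem_coe, mem_support_iff,
    Set.mem_ofPred_eq]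

theorem coeff_eq_zero_of_mem_weightLE {w : σ → ℤ} {k : ℤ} {f : MvPolynomial σ R}
    (hf : f ∈ weightLE R w k) {m : σ →₀ ℕ} (hm : k < Finsupp.weight w m) : coeff m f = 0 := by
  by_contra h
  exact absurd (mem_weightLE.1 hf m h) (not_le.2 hm)

theorem weightLE_mono (w : σ → ℤ) {k l : ℤ} (h : k ≤ l) : weightLE R w k ≤ weightLE R w l :=
  restrictSupport_mono (R := R) fun m (hm : Finsupp.weight w m ≤ k) =>
    show Finsupp.weight w m ≤ l from hm.trans h

theorem monomial_mem_weightLE {w : σ → ℤ} {k : ℤ} {m : σ →₀ ℕ} (h : Finsupp.weight w m ≤ k)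
    (c : R) : monomial m c ∈ weightLE R w k :=
  (monomial_mem_restrictSupport (R := R)).2 (Or.inl h)

theorem C_mem_weightLE {w : σ → ℤ} {k : ℤ} (hk : 0 ≤ k) (c : R) : C c ∈ weightLE R w k :=
  monomial_mem_weightLE (by simpa using hk) c

theorem one_mem_weightLE (w : σ → ℤ) : (1 : MvPolynomial σ R) ∈ weightLE R w 0 :=
  C_mem_weightLE le_rfl 1

theorem X_mem_weightLE {w : σ → ℤ} {k : ℤ} {v : σ} (h : w v ≤ k) :
    (X v : MvPolynomial σ R) ∈ weightLE R w k :=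
  monomial_mem_weightLE (by simpa [Finsupp.weight_single] using h) 1

theorem weightLE_mul_le (w : σ → ℤ) (k l : ℤ) :
    weightLE R w k * weightLE R w l ≤ weightLE R w (k + l) := by
  rw [weightLE, weightLE, ← restrictSupport_add]
  refine restrictSupport_mono (R := R) ?_
  rintro _ ⟨a, ha, b, hb, rfl⟩
  simp only [Set.mem_ofPred_eq, map_add] at *
  exact add_le_add ha hb

theorem mul_mem_weightLE {w : σ → ℤ} {k l s : ℤ} {f g : MvPolynomial σ R}
    (hf : f ∈ weightLE R w k) (hg : g ∈ weightLE R w l) (h : k + l ≤ s) :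
    f * g ∈ weightLE R w s :=
  weightLE_mono w h (weightLE_mul_le w k l (Submodule.mul_mem_mul hf hg))

theorem pow_mem_weightLE {w : σ → ℤ} {k : ℤ} {f : MvPolynomial σ R}
    (hf : f ∈ weightLE R w k) (e : ℕ) : f ^ e ∈ weightLE R w (e * k) := by
  induction e with
  | zero => simpa using one_mem_weightLE w
  | succ e ih =>
    rw [pow_succ]
    exact mul_mem_weightLE ih hf (by push_cast; linarith)

theorem prod_mem_weightLE {ι : Type*} {w : σ → ℤ} (s : Finset ι) (f : ι → MvPolynomial σ R)
    (k : ι → ℤ) (h : ∀ i ∈ s, f i ∈ weightLE R w (k i)) :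
    ∏ i ∈ s, f i ∈ weightLE R w (∑ i ∈ s, k i) := by
  classical
  induction s using Finset.induction_on with
  | empty => simpa using one_mem_weightLE w
  | insert a s ha ih =>
    rw [Finset.prod_insert ha, Finset.sum_insert ha]
    exact mul_mem_weightLE (h a (by simp)) (ih fun i hi => h i (by simp [hi])) le_rfl

theorem weight_eq_sum (w : σ → ℤ) (m : σ →₀ ℕ) :
    Finsupp.weight w m = ∑ v ∈ m.support, (m v : ℤ) * w v := by
  rw [Finsupp.weight_apply, Finsupp.sum]
  simp

theorem aeval_mem_weightLE {w : τ → ℤ} {u : σ → ℤ} (g : σ → MvPolynomial τ R)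
    (hg : ∀ v, g v ∈ weightLE R w (u v)) {k : ℤ} {f : MvPolynomial σ R}
    (hf : f ∈ weightLE R u k) : aeval g f ∈ weightLE R w k := by
  rw [f.as_sum, map_sum]
  refine Submodule.sum_mem _ fun m hm => ?_
  have h := mem_weightLE.1 hf m (mem_support_iff.1 hm)
  rw [aeval_monomial, Finsupp.prod]
  refine mul_mem_weightLE (C_mem_weightLE le_rfl (coeff m f))
    (prod_mem_weightLE _ _ (fun v => (m v : ℤ) * u v) fun v _ => pow_mem_weightLE (hg v) _) ?_
  rw [zero_add, ← weight_eq_sum]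
  exact h

theorem weight_eq_sum_univ [Fintype σ] (w : σ → ℤ) (m : σ →₀ ℕ) :
    Finsupp.weight w m = ∑ v, (m v : ℤ) * w v := by
  rw [weight_eq_sum]
  refine Finset.sum_subset (Finset.subset_univ _) fun v _ hv => ?_
  simp [Finsupp.notMem_support_iff.1 hv]

/-- The polynomial `f` is the sum of the monomial `m`, with coefficient one, and of monomials of
smaller weight. -/
def HasLeadingMonomial (w : σ → ℤ) (f : MvPolynomial σ R) (m : σ →₀ ℕ) : Prop :=
  f - monomial m 1 ∈ weightLE R w (Finsupp.weight w m - 1)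

namespace HasLeadingMonomial

variable {w : σ → ℤ} {f g : MvPolynomial σ R} {m l : σ →₀ ℕ}

theorem monomial (w : σ → ℤ) (m : σ →₀ ℕ) :
    HasLeadingMonomial w (MvPolynomial.monomial m (1 : R)) m := by
  simp [HasLeadingMonomial]

theorem X (w : σ → ℤ) (v : σ) :
    HasLeadingMonomial w (MvPolynomial.X v : MvPolynomial σ R) (Finsupp.single v 1) :=
  monomial w _

theorem one (w : σ → ℤ) : HasLeadingMonomial w (1 : MvPolynomial σ R) 0 :=
  monomial w 0

theorem add_of_lt (hf : HasLeadingMonomial w f m)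
    (hg : g ∈ weightLE R w (Finsupp.weight w m - 1)) : HasLeadingMonomial w (f + g) m := by
  rw [HasLeadingMonomial, add_sub_right_comm]
  exact Submodule.add_mem _ hf hg

theorem mem_weightLE (hf : HasLeadingMonomial w f m) : f ∈ weightLE R w (Finsupp.weight w m) := by
  rw [← sub_add_cancel f (MvPolynomial.monomial m 1)]
  exact Submodule.add_mem _ (weightLE_mono w (by omega) hf) (monomial_mem_weightLE le_rfl 1)

theorem mul (hf : HasLeadingMonomial w f m) (hg : HasLeadingMonomial w g l) :
    HasLeadingMonomial w (f * g) (m + l) := by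
  have h : f * g - MvPolynomial.monomial (m + l) 1 =
      (f - MvPolynomial.monomial m 1) * g +
        MvPolynomial.monomial m 1 * (g - MvPolynomial.monomial l 1) := by
    have : (MvPolynomial.monomial (m + l) 1 : MvPolynomial σ R) =
        MvPolynomial.monomial m 1 * MvPolynomial.monomial l 1 := by simp [monomial_mul]
    rw [this]
    ring
  rw [HasLeadingMonomial, h, map_add]
  exact Submodule.add_mem _ (mul_mem_weightLE hf hg.mem_weightLE (by omega))
    (mul_mem_weightLE (monomial_mem_weightLE le_rfl 1) hg (by omega))

theorem pow (hf : HasLeadingMonomial w f m) (e : ℕ) : HasLeadingMonomial w (f ^ e) (e • m) := by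
  induction e with
  | zero => simpa using one w
  | succ e ih =>
    rw [pow_succ, succ_nsmul]
    exact ih.mul hf

theorem prod {ι : Type*} (s : Finset ι) (f : ι → MvPolynomial σ R) (m : ι → σ →₀ ℕ)
    (h : ∀ i ∈ s, HasLeadingMonomial w (f i) (m i)) :
    HasLeadingMonomial w (∏ i ∈ s, f i) (∑ i ∈ s, m i) := by
  classical
  induction s using Finset.induction_on with
  | empty => simpa using one w
  | insert a s ha ih =>
    rw [Finset.prod_insert ha, Finset.sum_insert ha]
    exact (h a (by simp)).mul (ih fun i hi => h i (by simp [hi]))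

theorem aeval_monomial {w : τ → ℤ} (g : σ → MvPolynomial τ R) (d : σ → τ →₀ ℕ)
    (hg : ∀ v, HasLeadingMonomial w (g v) (d v)) (m : σ →₀ ℕ) :
    HasLeadingMonomial w (aeval g (MvPolynomial.monomial m (1 : R))) (m.sum fun v c => c • d v) := by
  rw [MvPolynomial.aeval_monomial, map_one, one_mul]
  exact prod _ _ _ fun v _ => (hg v).pow _

end HasLeadingMonomial

end Weights

/-! ### Invariants of column operations -/

section ColumnInvariants

variable {K : Type*} [Field K] {n : ℕ}

/-- The algebra endomorphism that adds column `j` to column `j'` of the generic matrix. -/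
def columnShear (K : Type*) [Field K] {n : ℕ} (j j' : Fin n) :
    MvPolynomial (Fin n × Fin n) K →ₐ[K] MvPolynomial (Fin n × Fin n) K :=
  aeval fun v => if v.2 = j' then X v + X (v.1, j) else X v

/-- The polynomials of degree `l j` in each column `j` of the generic matrix that are invariant
under the addition of a column to the next one. -/
def columnInvariants (K : Type*) [Field K] {n : ℕ} (l : Fin n → ℕ) :
    Submodule K (MvPolynomial (Fin n × Fin n) K) where
  carrier := {f | (∀ m, coeff m f ≠ 0 → ∀ j, ∑ i, m (i, j) = l j) ∧
    ∀ j j' : Fin n, (j' : ℕ) = j + 1 → columnShear K j j' f = f}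
  add_mem' := by
    rintro f g ⟨hf, hf'⟩ ⟨hg, hg'⟩
    refine ⟨fun m hm => ?_, fun j j' h => by rw [map_add, hf' j j' h, hg' j j' h]⟩
    by_cases h : coeff m f = 0
    · refine hg m fun h' => hm ?_
      rw [coeff_add, h, h', add_zero]
    · exact hf m h
  zero_mem' := ⟨fun m hm => absurd (coeff_zero m) hm, fun j j' _ => map_zero _⟩
  smul_mem' := by
    rintro c f ⟨hf, hf'⟩
    refine ⟨fun m hm => hf m fun h => hm ?_, fun j j' h => by rw [map_smul, hf' j j' h]⟩
    rw [coeff_smul, h, smul_zero]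

/-- The weight of the diagonal term order: `x (i, j)` has weight `i * j`. -/
def diagWeight (n : ℕ) (v : Fin n × Fin n) : ℤ := (v.1 : ℤ) * (v.2 : ℤ)

/-- This is the leading exponent after a substitution that sends the entries (i, j) and (i, j') to 1
and every other variable to a polynomial led by itself. -/
theorem eraseEntries_apply (i j j' : Fin n) (m : Fin n × Fin n →₀ ℕ) (v : Fin n × Fin n) :
    (m.sum fun u c => c • (if u.1 = i ∧ (u.2 = j ∨ u.2 = j') then (0 : Fin n × Fin n →₀ ℕ)
      else Finsupp.single u 1)) v = if v.1 = i ∧ (v.2 = j ∨ v.2 = j') then 0 else m v := by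
  rw [Finsupp.sum_apply, Finsupp.sum, Finset.sum_eq_single v]
  · split_ifs <;> simp
  · intro u _ huv
    split_ifs <;> simp [huv]
  · intro hv
    simp [Finsupp.notMem_support_iff.1 hv]

/-- If m (a, j) counts the entries a in row j of a tableau, this is semistandardness of that
tableau. A substitution that keeps track of m is compared, through the shear invariance of f, with
one under which each factor from column j' is killed or becomes a variable counted by the
inequality. -/
theorem sum_Iic_le_sum_Iio_of_mem_columnInvariants {l : Fin n → ℕ}
    {f : MvPolynomial (Fin n × Fin n) K} (hf : f ∈ columnInvariants K l)
    {m : Fin n × Fin n →₀ ℕ} (hm : coeff m f ≠ 0)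
    (hmax : f ∈ weightLE K (diagWeight n) (Finsupp.weight (diagWeight n) m))
    {j j' : Fin n} (hj : (j' : ℕ) = j + 1) (i : Fin n) :
    ∑ a ∈ Finset.Iic i, m (a, j') ≤ ∑ a ∈ Finset.Iio i, m (a, j) := by
  classical
  have hne : j ≠ j' := fun h => by rw [h] at hj; omega
  -- All monomials of f have the same column degrees, so on them `w` differs from the diagonal
  -- weight by a constant. The shift by i makes row i weightless and reverses the order of columns j
  -- and j' in the rows above it.
  let w : Fin n × Fin n → ℤ := fun v => ((v.1 : ℤ) - i) * v.2
  let g : Fin n × Fin n → MvPolynomial (Fin n × Fin n) K := fun v =>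
    if v.2 = j then (if v.1 < i then X v + X (v.1, j') else if v.1 = i then 1 else X v)
    else if v.2 = j' then (if v.1 < i then X v else if v.1 = i then 1 else X v + X (v.1, j))
    else X v
  -- Column j' of `g'` is column j' of `g` minus column j of `g`.
  let g' : Fin n × Fin n → MvPolynomial (Fin n × Fin n) K := fun v =>
    if v.2 = j' then (if v.1 < i then -X (v.1, j) else if v.1 = i then 0 else X v) else g v
  let d : Fin n × Fin n → Fin n × Fin n →₀ ℕ := fun u =>
    if u.1 = i ∧ (u.2 = j ∨ u.2 = j') then 0 else Finsupp.single u 1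
  let E : (Fin n × Fin n →₀ ℕ) → (Fin n × Fin n →₀ ℕ) := fun m => m.sum fun u c => c • d u
  have hE : ∀ m v, E m v = if v.1 = i ∧ (v.2 = j ∨ v.2 = j') then 0 else m v :=
    eraseEntries_apply i j j'
  have hw : ∀ m, coeff m f ≠ 0 → Finsupp.weight w m =
      Finsupp.weight (diagWeight n) m - i * ∑ b : Fin n, (b : ℤ) * l b := by
    intro m hm
    simp only [← hf.1 m hm, weight_eq_sum_univ, w, diagWeight, Fintype.sum_prod_type_right,
      Nat.cast_sum, Finset.mul_sum, ← Finset.sum_sub_distrib]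
    exact Finset.sum_congr rfl fun b _ => Finset.sum_congr rfl fun a _ => by ring
  have hwE : ∀ m, Finsupp.weight w (E m) = Finsupp.weight w m := by
    intro m
    rw [weight_eq_sum_univ, weight_eq_sum_univ]
    refine Finset.sum_congr rfl fun v _ => ?_
    rw [hE]
    split_ifs with h
    · simp [w, h.1]
    · rfl
  have hlead : ∀ v, HasLeadingMonomial w (g v) (d v) := by
    intro v
    obtain ⟨a, b⟩ := v
    have hlt : ∀ a b : Fin n, a < b → (a : ℤ) < b := fun a b h => by exact_mod_cast h
    have hj' : (j' : ℤ) = j + 1 := by exact_mod_cast hj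
    by_cases hb : b = j
    · subst hb
      rcases lt_trichotomy a i with h | h | h
      · simp only [g, d, h, h.ne, if_true, false_and, if_false]
        refine (HasLeadingMonomial.X w _).add_of_lt (X_mem_weightLE ?_)
        have := hlt _ _ h
        simp only [w, Finsupp.weight_single, one_smul, hj']
        linarith
      · simp only [g, d, h, lt_irrefl, if_true, if_false, true_and, true_or]
        exact HasLeadingMonomial.one w
      · simp only [g, d, h.not_gt, h.ne', if_true, if_false, false_and]
        exact HasLeadingMonomial.X w _
    · by_cases hb' : b = j'
      · subst hb'
        rcases lt_trichotomy a i with h | h | h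
        · simp only [g, d, h, h.ne, hb, if_true, false_and, if_false]
          exact HasLeadingMonomial.X w _
        · simp only [g, d, h, hb, lt_irrefl, if_true, if_false, true_and, or_true]
          exact HasLeadingMonomial.one w
        · simp only [g, d, h.not_gt, h.ne', hb, if_true, if_false, false_and]
          refine (HasLeadingMonomial.X w _).add_of_lt (X_mem_weightLE ?_)
          have := hlt _ _ h
          simp only [w, Finsupp.weight_single, one_smul, hj']
          linarith
      · simp only [g, d, hb, hb', if_false, or_false, and_false]
        exact HasLeadingMonomial.X w _
  -- No other monomial m' of f reaches E m: its weight is at most that of m, and E m' = E m would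
  -- force m' = m, since the erased entries are recovered from the column degrees.
  have hcoeff : coeff (E m) (aeval g f) = coeff m f := by
    conv_lhs => rw [f.as_sum, map_sum]
    rw [coeff_sum, Finset.sum_eq_single m]
    · have h := coeff_eq_zero_of_mem_weightLE (HasLeadingMonomial.aeval_monomial g d hlead m)
        (m := E m) (by change Finsupp.weight w (E m) - 1 < _; omega)
      rw [coeff_sub, coeff_monomial, if_pos rfl, sub_eq_zero] at h
      rw [← mul_one (coeff m f), ← smul_eq_mul, ← smul_monomial, map_smul, coeff_smul, h]
    · intro m' hm' hne'
      rw [mem_support_iff] at hm'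
      have hle := mem_weightLE.1 hmax m' hm'
      have h1 := hw m hm
      have h2 := hw m' hm'
      have h := coeff_eq_zero_of_mem_weightLE (HasLeadingMonomial.aeval_monomial g d hlead m')
        (m := E m) (by
          change Finsupp.weight w (E m') - 1 < _
          rw [hwE, hwE]
          omega)
      rw [coeff_sub, coeff_monomial, if_neg, sub_zero] at h
      · rw [← mul_one (coeff m' f), ← smul_eq_mul, ← smul_monomial, map_smul, coeff_smul, h,
          smul_zero]
      · intro hEE
        apply hne'
        have hoff : ∀ v : Fin n × Fin n, v.1 ≠ i → m' v = m v := by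
          intro v hv
          have := DFunLike.congr_fun hEE v
          change E m' v = E m v at this
          simpa [hE, hv] using this
        ext ⟨a, b⟩
        by_cases ha : a = i
        · subst ha
          have h1 := hf.1 m hm b
          have h2 := hf.1 m' hm' b
          rw [← Finset.add_sum_erase _ _ (Finset.mem_univ a)] at h1 h2
          rw [Finset.sum_congr rfl fun c hc => hoff (c, b) (Finset.ne_of_mem_erase hc)] at h2
          omega
        · exact hoff _ ha
    · intro h
      rw [notMem_support_iff] at h
      exact absurd h hm
  have hshear : aeval g f = aeval g' f := by
    conv_rhs => rw [← hf.2 j j' hj]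
    rw [← AlgHom.comp_apply]
    congr 1
    ext v
    obtain ⟨a, b⟩ := v
    simp only [aeval_X, AlgHom.comp_apply, columnShear]
    by_cases hb : b = j'
    · subst hb
      simp only [if_true, map_add, aeval_X, g', g, hne, hne.symm, if_false]
      split_ifs <;> simp
    · simp only [hb, if_false, aeval_X, g']
  -- With weight -1 on the variables to be counted, "weight at most -l j'" means "degree at least l
  -- j'". Each of the l j' factors from column j' becomes zero or, up to sign, such a variable.
  have hdeg : aeval g' f ∈ weightLE K (fun v : Fin n × Fin n =>
      if (v.2 = j ∧ v.1 < i) ∨ (v.2 = j' ∧ i < v.1) then -1 else 0) (-(l j' : ℤ)) := by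
    refine aeval_mem_weightLE (u := fun v : Fin n × Fin n => if v.2 = j' then -1 else 0) g' ?_ ?_
    · rintro ⟨a, b⟩
      by_cases hb' : b = j'
      · subst hb'
        rcases lt_trichotomy a i with h | h | h
        · simp only [g', h, if_true]
          exact Submodule.neg_mem _ (X_mem_weightLE (by simp [h]))
        · simp only [g', h, lt_irrefl, if_true, if_false]
          exact Submodule.zero_mem _
        · simp only [g', h.not_gt, h.ne', if_true, if_false]
          exact X_mem_weightLE (by simp [h])
      · have hnonpos : ∀ v : Fin n × Fin n,
            (if (v.2 = j ∧ v.1 < i) ∨ (v.2 = j' ∧ i < v.1) then (-1 : ℤ) else 0) ≤ 0 := by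
          intro v
          split_ifs <;> simp
        simp only [g', g, hb', if_false]
        split_ifs
        · exact Submodule.add_mem _ (X_mem_weightLE (hnonpos _)) (X_mem_weightLE (hnonpos _))
        · exact one_mem_weightLE _
        · exact X_mem_weightLE (hnonpos _)
        · exact X_mem_weightLE (hnonpos _)
    · refine mem_weightLE.2 fun m' hm' => ?_
      rw [weight_eq_sum_univ, Fintype.sum_prod_type_right, Finset.sum_eq_single j']
      · simp [← hf.1 m' hm' j']
      · intro b _ hb
        simp [hb]
      · simp
  have hfin := mem_weightLE.1 hdeg (E m) (by rw [← hshear, hcoeff]; exact hm)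
  have hsum : Finsupp.weight (fun v : Fin n × Fin n =>
      if (v.2 = j ∧ v.1 < i) ∨ (v.2 = j' ∧ i < v.1) then (-1 : ℤ) else 0) (E m) =
      -((∑ a ∈ Finset.Iio i, m (a, j) : ℕ) + (∑ a ∈ Finset.Ioi i, m (a, j') : ℕ) : ℤ) := by
    rw [weight_eq_sum_univ, Fintype.sum_prod_type_right,
      Fintype.sum_eq_add j j' hne (fun b hb => by simp [hb.1, hb.2])]
    have h1 : ∀ a, (E m (a, j) : ℤ) * (if ((a, j).2 = j ∧ (a, j).1 < i) ∨
        ((a, j).2 = j' ∧ i < (a, j).1) then (-1 : ℤ) else 0) =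
        if a < i then -(m (a, j) : ℤ) else 0 := by
      intro a
      rw [hE]
      by_cases h : a < i
      · simp [h, h.ne]
      · simp [h, hne]
    have h2 : ∀ a, (E m (a, j') : ℤ) * (if ((a, j').2 = j ∧ (a, j').1 < i) ∨
        ((a, j').2 = j' ∧ i < (a, j').1) then (-1 : ℤ) else 0) =
        if i < a then -(m (a, j') : ℤ) else 0 := by
      intro a
      rw [hE]
      by_cases h : i < a
      · simp [h, h.ne']
      · simp [h, hne.symm]
    rw [Finset.sum_congr rfl fun a _ => h1 a, Finset.sum_congr rfl fun a _ => h2 a,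
      ← Finset.sum_filter, ← Finset.sum_filter, Finset.sum_neg_distrib, Finset.sum_neg_distrib,
      neg_add]
    push_cast
    congr 3 <;> ext a <;> simp
  have hl := hf.1 m hm j'
  have hsplit : ∑ a, m (a, j') = ∑ a ∈ Finset.Iic i, m (a, j') + ∑ a ∈ Finset.Ioi i, m (a, j') := by
    rw [← Finset.sum_union (Finset.disjoint_left.2 fun a ha hb => by
      simp only [Finset.mem_Iic, Finset.mem_Ioi] at ha hb
      exact absurd ha (not_le.2 hb))]
    congr 1
    ext a
    simp [le_or_gt]
  rw [hsum] at hfin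
  omega

end ColumnInvariants

/-! ### Spanning of the column invariants by products of minors -/

section FundamentalTheorem

variable {K : Type*} [Field K] {n : ℕ}

/-- The span of the minors of the generic matrix on the columns in `J`, with arbitrary rows. -/
def columnMinorSpan (K : Type*) [Field K] {n : ℕ} (J : Finset (Fin n)) :
    Submodule K (MvPolynomial (Fin n × Fin n) K) :=
  Submodule.span K (Set.range fun I : J → Fin n =>
    Matrix.det (Matrix.of fun a b : J => (X (I a, (b : Fin n)) : MvPolynomial (Fin n × Fin n) K)))

/-- The span of the products, over the columns `c < N` of a diagram with row lengths `l`, of minors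
on the rows of the diagram that meet the column `c`. -/
def minorProductSpan (K : Type*) [Field K] {n : ℕ} (l : Fin n → ℕ) (N : ℕ) :
    Submodule K (MvPolynomial (Fin n × Fin n) K) :=
  ∏ c ∈ Finset.range N, columnMinorSpan K (Finset.univ.filter fun j => c < l j)

theorem minorProductSpan_eq_span (l : Fin n → ℕ) (N : ℕ) :
    minorProductSpan K l N = Submodule.span K (Set.range
      fun I : (c : ℕ) → (Finset.univ.filter fun j => c < l j : Finset (Fin n)) → Fin n =>
        ∏ c ∈ Finset.range N, Matrix.det (Matrix.of
          fun a b : (Finset.univ.filter fun j => c < l j : Finset (Fin n)) =>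
            (X (I c a, (b : Fin n)) : MvPolynomial (Fin n × Fin n) K))) := by
  classical
  rw [minorProductSpan]
  simp only [columnMinorSpan]
  rw [Submodule.prod_span]
  congr 1
  ext f
  rw [Set.mem_finsetProd]
  constructor
  · rintro ⟨g, hg, rfl⟩
    have hI : ∀ c, ∃ I : (Finset.univ.filter fun j => c < l j : Finset (Fin n)) → Fin n,
        c ∈ Finset.range N → Matrix.det (Matrix.of fun a b => X (I a, (b : Fin n))) = g c := by
      intro c
      by_cases hc : c ∈ Finset.range N
      · obtain ⟨I, hI⟩ := hg hc
        exact ⟨I, fun _ => hI⟩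
      · exact ⟨fun b => b, fun h => absurd h hc⟩
    choose I hI using hI
    exact ⟨I, Finset.prod_congr rfl fun c hc => hI c hc⟩
  · rintro ⟨I, rfl⟩
    exact ⟨_, fun {c} _ => ⟨I c, rfl⟩, rfl⟩

/-- By the rearrangement inequality the diagonal term, where rows and columns are paired in
increasing order, has strictly larger weight than every other term. -/
theorem hasLeadingMonomial_det {J : Finset (Fin n)} {I : J → Fin n} (hI : StrictMono I) :
    HasLeadingMonomial (diagWeight n)
      (Matrix.det (Matrix.of fun a b : J =>
        (X (I a, (b : Fin n)) : MvPolynomial (Fin n × Fin n) K)))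
      (∑ b : J, Finsupp.single (I b, (b : Fin n)) 1) := by
  classical
  rw [Matrix.det_apply, ← Finset.add_sum_erase _ _ (Finset.mem_univ (1 : Equiv.Perm J))]
  refine HasLeadingMonomial.add_of_lt ?_ (Submodule.sum_mem _ fun s hs => ?_)
  · simp only [Equiv.Perm.sign_one, one_smul, Matrix.of_apply, Equiv.Perm.coe_one, id_eq]
    exact HasLeadingMonomial.prod _ _ _ fun b _ => HasLeadingMonomial.X _ _
  · have hmem : (∏ b : J, Matrix.of (fun a b : J =>
        (X (I a, (b : Fin n)) : MvPolynomial (Fin n × Fin n) K)) (s b) b) ∈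
        weightLE K (diagWeight n) (∑ b : J, ((I (s b) : ℕ) : ℤ) * ((b : Fin n) : ℕ)) :=
      prod_mem_weightLE _ _ _ fun b _ => X_mem_weightLE le_rfl
    have hlt : ∑ b : J, ((I (s b) : ℕ) : ℤ) * ((b : Fin n) : ℕ) <
        ∑ b : J, ((I b : ℕ) : ℤ) * ((b : Fin n) : ℕ) := by
      have hmono : Monovary (fun b : J => ((I b : ℕ) : ℤ))
          (fun b : J => (((b : Fin n) : ℕ) : ℤ)) := by
        intro a b hab
        have hab' : a < b := by simpa using hab
        simpa using (hI hab').le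
      refine (hmono.sum_comp_perm_mul_lt_sum_mul_iff (σ := s)).2 fun h => ?_
      refine Finset.ne_of_mem_erase hs (Equiv.ext fun b => ?_)
      have hs' : StrictMono s := by
        intro a b hab
        have hab' : (((a : Fin n) : ℕ) : ℤ) < ((b : Fin n) : ℕ) := by exact_mod_cast hab
        have h1 : I (s a) ≤ I (s b) := by simpa using h hab'
        exact lt_of_le_of_ne (hI.le_iff_le.1 h1) (s.injective.ne hab.ne)
      exact congrFun ((hs'.range_inj strictMono_id).1 (by simp [s.surjective.range_eq])) b
    have hle : (∏ b : J, Matrix.of (fun a b : J =>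
        (X (I a, (b : Fin n)) : MvPolynomial (Fin n × Fin n) K)) (s b) b) ∈
        weightLE K (diagWeight n) (Finsupp.weight (diagWeight n)
          (∑ b : J, Finsupp.single (I b, (b : Fin n)) 1) - 1) := by
      refine weightLE_mono _ ?_ hmem
      rw [map_sum]
      simp only [Finsupp.weight_single, one_smul, diagWeight]
      omega
    rcases Int.units_eq_one_or (Equiv.Perm.sign s) with h | h
    · rw [h, one_smul]
      exact hle
    · rw [h, Units.neg_smul, one_smul]
      exact Submodule.neg_mem _ hle

/-- In a weakly increasing word with a i letters i, this finds the letter at position c. -/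
theorem exists_sum_Iio_le_lt_sum_Iic (a : Fin n → ℕ) {c : ℕ} (hc : c < ∑ i, a i) :
    ∃ i, ∑ x ∈ Finset.Iio i, a x ≤ c ∧ c < ∑ x ∈ Finset.Iic i, a x := by
  classical
  by_contra! h
  have key : ∀ k (hk : k < n), ∑ x ∈ Finset.Iic (⟨k, hk⟩ : Fin n), a x ≤ c := by
    intro k
    induction k with
    | zero =>
      intro hk
      refine h _ ?_
      rw [Finset.sum_eq_zero]
      · exact Nat.zero_le _
      · intro x hx
        exact absurd (Fin.lt_def.1 (Finset.mem_Iio.1 hx)) (Nat.not_lt_zero _)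
    | succ k ih =>
      intro hk
      refine h _ ?_
      convert ih (by omega) using 2
      ext x
      simp only [Finset.mem_Iio, Finset.mem_Iic, Fin.lt_def, Fin.le_def]
      omega
  rcases n with _ | n
  · simp at hc
  · have := key n (by omega)
    have h2 : Finset.Iic (⟨n, by omega⟩ : Fin (n + 1)) = Finset.univ := by
      ext x
      simp only [Finset.mem_Iic, Finset.mem_univ, Fin.le_def, iff_true]
      omega
    rw [h2] at this
    omega

theorem sum_Iic_le_sum_Iio_of_lt (a : Fin n → ℕ) {i j : Fin n} (h : i < j) :
    ∑ x ∈ Finset.Iic i, a x ≤ ∑ x ∈ Finset.Iio j, a x :=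
  Finset.sum_le_sum_of_subset fun x hx => by
    simp only [Finset.mem_Iic, Finset.mem_Iio] at *
    exact hx.trans_lt h

theorem sum_Iio_add (a : Fin n → ℕ) (i : Fin n) :
    ∑ x ∈ Finset.Iio i, a x + a i = ∑ x ∈ Finset.Iic i, a x := by
  rw [← Finset.Iio_insert, Finset.sum_insert (by simp), add_comm]

/-- A monomial whose exponent matrix describes a semistandard tableau is the leading monomial of a
product of minors. -/
theorem exists_hasLeadingMonomial_of_semistandard {l : Fin n → ℕ} (hl : Antitone l) {N : ℕ}
    (hN : ∀ j, l j ≤ N) {m : Fin n × Fin n →₀ ℕ} (hm : ∀ j, ∑ i, m (i, j) = l j)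
    (hss : ∀ j j' : Fin n, (j' : ℕ) = j + 1 → ∀ i,
      ∑ a ∈ Finset.Iic i, m (a, j') ≤ ∑ a ∈ Finset.Iio i, m (a, j)) :
    ∃ P ∈ minorProductSpan K l N, HasLeadingMonomial (diagWeight n) P m := by
  classical
  -- `T j c` is the entry in row j and column c of the tableau whose row j is weakly increasing with
  -- m (i, j) entries i. The value outside the diagram is arbitrary.
  have hT : ∀ (j : Fin n) (c : ℕ), ∃ i : Fin n, c < l j →
      ∑ x ∈ Finset.Iio i, m (x, j) ≤ c ∧ c < ∑ x ∈ Finset.Iic i, m (x, j) := by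
    intro j c
    by_cases h : c < l j
    · obtain ⟨i, hi⟩ := exists_sum_Iio_le_lt_sum_Iic (fun x => m (x, j)) (by rwa [hm j])
      exact ⟨i, fun _ => hi⟩
    · exact ⟨j, fun h' => absurd h' h⟩
  choose T hT using hT
  -- Columns of the tableau increase strictly, which makes the diagonal term of each column minor
  -- its leading term.
  have hstep : ∀ (c k : ℕ) (b b' : Fin n), (b' : ℕ) = b + k + 1 → c < l b' → T b c < T b' c := by
    intro c k
    induction k with
    | zero =>
      intro b b' hbb hc
      have hc' : c < l b := hc.trans_le (hl (Fin.le_def.2 (by omega)))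
      by_contra hle
      have h1 := (hT b' c hc).2
      have h2 := hss b b' (by omega) (T b' c)
      have h3 := (hT b c hc').1
      have h4 : ∑ x ∈ Finset.Iio (T b' c), m (x, b) ≤ ∑ x ∈ Finset.Iio (T b c), m (x, b) :=
        Finset.sum_le_sum_of_subset fun x hx => by
          simp only [Finset.mem_Iio] at *
          exact hx.trans_le (not_lt.1 hle)
      omega
    | succ k ih =>
      intro b b' hbb hc
      have hlt : (b : ℕ) + k + 1 < n := by omega
      have hc' : c < l ⟨(b : ℕ) + k + 1, hlt⟩ :=
        hc.trans_le (hl (Fin.le_def.2 (by simp only []; omega)))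
      refine (ih b ⟨(b : ℕ) + k + 1, hlt⟩ rfl hc').trans ?_
      by_contra hle
      have h1 := (hT b' c hc).2
      have h2 := hss ⟨(b : ℕ) + k + 1, hlt⟩ b' (by simp only []; omega) (T b' c)
      have h3 := (hT _ c hc').1
      have h4 : ∑ x ∈ Finset.Iio (T b' c), m (x, ⟨(b : ℕ) + k + 1, hlt⟩) ≤
          ∑ x ∈ Finset.Iio (T ⟨(b : ℕ) + k + 1, hlt⟩ c), m (x, ⟨(b : ℕ) + k + 1, hlt⟩) :=
        Finset.sum_le_sum_of_subset fun x hx => by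
          simp only [Finset.mem_Iio] at *
          exact hx.trans_le (not_lt.1 hle)
      omega
  let J : ℕ → Finset (Fin n) := fun c => Finset.univ.filter fun j => c < l j
  have hJ : ∀ c, StrictMono fun b : J c => T (b : Fin n) c := by
    intro c b b' hbb
    have hlt : ((b : Fin n) : ℕ) < (b' : Fin n) := by exact_mod_cast hbb
    exact hstep c ((b' : Fin n) - (b : Fin n) - 1) b b' (by omega)
      (Finset.mem_filter.1 b'.2).2
  refine ⟨∏ c ∈ Finset.range N, Matrix.det (Matrix.of fun a b : J c =>
    (X (T (a : Fin n) c, (b : Fin n)) : MvPolynomial (Fin n × Fin n) K)), ?_, ?_⟩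
  · rw [minorProductSpan_eq_span]
    exact Submodule.subset_span ⟨fun c b => T (b : Fin n) c, rfl⟩
  · have hsum : m = ∑ c ∈ Finset.range N, ∑ b : J c,
        Finsupp.single (T (b : Fin n) c, (b : Fin n)) 1 := by
      ext ⟨i, j⟩
      have hone : ∀ c, (∑ b : J c, Finsupp.single (T (b : Fin n) c, (b : Fin n)) 1) (i, j) =
          if c < l j ∧ T j c = i then 1 else 0 := by
        intro c
        rw [Finset.sum_coe_sort (J c) fun b => Finsupp.single (T b c, b) 1, Finsupp.finsetSum_apply]
        by_cases hc : c < l j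
        · rw [Finset.sum_eq_single_of_mem j (by simp [J, hc])]
          · simp [Finsupp.single_apply, hc]
          · intro b _ hb
            simp [hb]
        · rw [if_neg fun h => hc h.1]
          refine Finset.sum_eq_zero fun b hb => ?_
          have : b ≠ j := by
            rintro rfl
            exact hc (by simpa [J] using hb)
          simp [this]
      rw [Finsupp.finsetSum_apply, Finset.sum_congr rfl fun c _ => hone c, Finset.sum_boole]
      -- The cells of row j with entry i are consecutive, and there are m (i, j) of them.
      have hIco : (Finset.range N).filter (fun c => c < l j ∧ T j c = i) =
          Finset.Ico (∑ x ∈ Finset.Iio i, m (x, j)) (∑ x ∈ Finset.Iic i, m (x, j)) := by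
        ext c
        simp only [Finset.mem_filter, Finset.mem_range, Finset.mem_Ico]
        constructor
        · rintro ⟨_, hc, rfl⟩
          exact hT j c hc
        · rintro ⟨h1, h2⟩
          have hc : c < l j := by
            rw [← hm j]
            exact h2.trans_le (Finset.sum_le_sum_of_subset (Finset.subset_univ _))
          refine ⟨hc.trans_le (hN j), hc, ?_⟩
          have h3 := hT j c hc
          rcases lt_trichotomy (T j c) i with h | h | h
          · have := sum_Iic_le_sum_Iio_of_lt (fun x => m (x, j)) h
            omega
          · exact h
          · have := sum_Iic_le_sum_Iio_of_lt (fun x => m (x, j)) h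
            omega
      rw [hIco, Nat.card_Ico, ← sum_Iio_add (fun x => m (x, j)) i]
      simp
    rw [hsum]
    exact HasLeadingMonomial.prod _ _ _ fun c _ => hasLeadingMonomial_det (hJ c)

/-- The first fundamental theorem for the group of upper unitriangular matrices: its polynomial
invariants are spanned by the products of minors. -/
theorem columnInvariants_le_minorProductSpan {l : Fin n → ℕ} (hl : Antitone l) {N : ℕ}
    (hN : ∀ j, l j ≤ N) (h : minorProductSpan K l N ≤ columnInvariants K l) :
    columnInvariants K l ≤ minorProductSpan K l N := by
  classical
  -- Induction on the top weight. The bound k - 1 makes the base case the zero polynomial, as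
  -- diagonal weights are nonnegative.
  suffices key : ∀ (k : ℕ) (f : MvPolynomial (Fin n × Fin n) K), f ∈ columnInvariants K l →
      f ∈ weightLE K (diagWeight n) ((k : ℤ) - 1) → f ∈ minorProductSpan K l N by
    intro f hf
    obtain ⟨k, hk⟩ : ∃ k : ℕ, f ∈ weightLE K (diagWeight n) ((k : ℤ) - 1) := by
      refine ⟨(∑ m ∈ f.support, Finsupp.weight (diagWeight n) m).toNat + 1,
        mem_weightLE.2 fun m hm => ?_⟩
      have hnonneg : ∀ m : Fin n × Fin n →₀ ℕ, 0 ≤ Finsupp.weight (diagWeight n) m := by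
        intro m
        rw [weight_eq_sum_univ]
        refine Finset.sum_nonneg fun v _ => ?_
        simp only [diagWeight]
        positivity
      have := Finset.single_le_sum (fun m _ => hnonneg m) (mem_support_iff.2 hm)
      push_cast
      omega
    exact key k f hf hk
  intro k
  induction k with
  | zero =>
    intro f _ hf
    have : f = 0 := by
      ext m
      rw [coeff_zero]
      refine coeff_eq_zero_of_mem_weightLE hf ?_
      rw [weight_eq_sum_univ]
      have : 0 ≤ ∑ v, (m v : ℤ) * diagWeight n v := by
        refine Finset.sum_nonneg fun v _ => ?_
        simp only [diagWeight]
        positivity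
      push_cast
      omega
    rw [this]
    exact Submodule.zero_mem _
  | succ k ih =>
    intro f hf hk
    rw [Nat.cast_succ, add_sub_cancel_right] at hk
    have hP : ∀ m, ∃ P ∈ minorProductSpan K l N, coeff m f ≠ 0 →
        Finsupp.weight (diagWeight n) m = k → HasLeadingMonomial (diagWeight n) P m := by
      intro m
      by_cases hm : coeff m f ≠ 0 ∧ Finsupp.weight (diagWeight n) m = k
      · obtain ⟨P, hP, hlead⟩ := exists_hasLeadingMonomial_of_semistandard (K := K) hl hN
          (hf.1 m hm.1) fun j j' hj i =>
            sum_Iic_le_sum_Iio_of_mem_columnInvariants hf hm.1 (by rwa [hm.2]) hj i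
        exact ⟨P, hP, fun _ _ => hlead⟩
      · exact ⟨0, Submodule.zero_mem _, fun h1 h2 => absurd ⟨h1, h2⟩ hm⟩
    choose P hP hlead using hP
    let s := f.support.filter fun m => Finsupp.weight (diagWeight n) m = k
    have hg : ∑ m ∈ s, coeff m f • P m ∈ minorProductSpan K l N :=
      Submodule.sum_mem _ fun m _ => Submodule.smul_mem _ _ (hP m)
    rw [← sub_add_cancel f (∑ m ∈ s, coeff m f • P m)]
    -- Subtracting the products of minors removes all monomials of weight k. The hypothesis `h`
    -- keeps the difference invariant; it is supplied later by the highest weight vector.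
    refine Submodule.add_mem _ (ih _ (Submodule.sub_mem _ hf (h hg)) ?_) hg
    have hsplit : f - ∑ m ∈ s, coeff m f • P m =
        (∑ m ∈ f.support.filter fun m => ¬ Finsupp.weight (diagWeight n) m = k,
          monomial m (coeff m f)) - ∑ m ∈ s, coeff m f • (P m - monomial m 1) := by
      have hfs := f.as_sum
      rw [← Finset.sum_filter_add_sum_filter_not f.support
        (fun m => Finsupp.weight (diagWeight n) m = k)] at hfs
      simp only [smul_sub, smul_monomial, smul_eq_mul, mul_one, Finset.sum_sub_distrib]
      nth_rewrite 1 [hfs]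
      abel
    rw [hsplit]
    refine Submodule.sub_mem _ (Submodule.sum_mem _ fun m hm => ?_)
      (Submodule.sum_mem _ fun m hm => Submodule.smul_mem _ _ ?_)
    · rw [Finset.mem_filter, mem_support_iff] at hm
      have := mem_weightLE.1 hk m hm.1
      exact monomial_mem_weightLE (by omega) _
    · rw [Finset.mem_filter, mem_support_iff] at hm
      have := hlead m hm.1 hm.2
      rwa [HasLeadingMonomial, hm.2] at this

end FundamentalTheorem

/-! ### The Schur algebra and polynomials in matrix entries -/

section SchurPairing

variable {K : Type*} [Field K] {n r : ℕ}

/-- The basis of tensor space that consists of the pure tensors of standard basis vectors. -/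
def tensorBasis (K : Type*) [Field K] (n r : ℕ) :
    Module.Basis (Fin r → Fin n) K (TensorSpace K n r) :=
  Basis.piTensorProduct fun _ : Fin r => Pi.basisFun K (Fin n)

theorem tensorBasis_apply (p : Fin r → Fin n) :
    tensorBasis K n r p = PiTensorProduct.tprod K fun a => Pi.single (p a) (1 : K) := by
  rw [tensorBasis, Basis.piTensorProduct_apply]
  simp

theorem tensorBasis_repr_tprod (v : Fin r → Fin n → K) (p : Fin r → Fin n) :
    (tensorBasis K n r).repr (PiTensorProduct.tprod K v) p = ∏ a, v a (p a) := by
  rw [tensorBasis, Basis.piTensorProduct_repr_tprod_apply]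
  simp

theorem placePerm_tensorBasis (s : Equiv.Perm (Fin r)) (p : Fin r → Fin n) :
    placePerm K n r s (tensorBasis K n r p) = tensorBasis K n r (p ∘ s.symm) := by
  rw [tensorBasis_apply, placePerm_tprod, tensorBasis_apply]
  rfl

theorem tensorBasis_repr_placePerm (s : Equiv.Perm (Fin r)) (t : TensorSpace K n r)
    (p : Fin r → Fin n) :
    (tensorBasis K n r).repr (placePerm K n r s t) p = (tensorBasis K n r).repr t (p ∘ s) := by
  have h : (Finsupp.lapply (R := K) p ∘ₗ (tensorBasis K n r).repr.toLinearMap ∘ₗ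
      (placePerm K n r s).toLinearMap) =
      Finsupp.lapply (R := K) (p ∘ s) ∘ₗ (tensorBasis K n r).repr.toLinearMap := by
    refine (tensorBasis K n r).ext fun q => ?_
    simp only [LinearMap.comp_apply, LinearEquiv.coe_coe, placePerm_tensorBasis,
      Module.Basis.repr_self, Finsupp.lapply_apply, Finsupp.single_apply]
    congr 1
    refine propext ⟨?_, ?_⟩
    · rintro rfl
      funext a
      simp
    · rintro rfl
      funext a
      simp
  exact LinearMap.congr_fun h t

/-- The exponent of the monomial that is the product of the entries `x (p a, q a)`. -/
def pairExponent (p q : Fin r → Fin n) : Fin n × Fin n →₀ ℕ :=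
  ∑ a, Finsupp.single (p a, q a) 1

theorem pairExponent_apply (p q : Fin r → Fin n) (v : Fin n × Fin n) :
    pairExponent p q v = (Finset.univ.filter fun a => (p a, q a) = v).card := by
  rw [pairExponent, Finsupp.finsetSum_apply, Finset.card_filter]
  simp only [Finsupp.single_apply]

theorem pairExponent_comp (p q : Fin r → Fin n) (s : Equiv.Perm (Fin r)) :
    pairExponent (p ∘ s) (q ∘ s) = pairExponent p q :=
  Equiv.sum_comp s fun a => Finsupp.single (p a, q a) 1

/-- Both pairs take each value (i, j) equally often, so bijections between the fibres assemble to a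
permutation. -/
theorem exists_perm_of_pairExponent_eq {p q p' q' : Fin r → Fin n}
    (h : pairExponent p q = pairExponent p' q') :
    ∃ s : Equiv.Perm (Fin r), p' ∘ s = p ∧ q' ∘ s = q := by
  have e : ∀ v, Nonempty ({a // (p a, q a) = v} ≃ {a // (p' a, q' a) = v}) := by
    intro v
    refine ⟨Fintype.equivOfCardEq ?_⟩
    rw [Fintype.card_subtype, Fintype.card_subtype, ← pairExponent_apply, ← pairExponent_apply, h]
  let s : Equiv.Perm (Fin r) := Equiv.ofFiberEquiv fun v => (e v).some
  have hs : ∀ a, (p' (s a), q' (s a)) = (p a, q a) := fun a =>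
    Equiv.ofFiberEquiv_map (f := fun a => (p a, q a)) (g := fun a => (p' a, q' a))
      (fun v => (e v).some) a
  exact ⟨s, funext fun a => (Prod.ext_iff.1 (hs a)).1, funext fun a => (Prod.ext_iff.1 (hs a)).2⟩

theorem sum_pairExponent_row (p q : Fin r → Fin n) (i : Fin n) :
    ∑ j, pairExponent p q (i, j) = (Finset.univ.filter fun a => p a = i).card := by
  simp only [pairExponent_apply, Finset.card_filter]
  rw [Finset.sum_comm]
  refine Finset.sum_congr rfl fun a _ => ?_
  by_cases h : p a = i <;> simp [h]

theorem sum_pairExponent_column (p q : Fin r → Fin n) (j : Fin n) :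
    ∑ i, pairExponent p q (i, j) = (Finset.univ.filter fun a => q a = j).card := by
  simp only [pairExponent_apply, Finset.card_filter]
  rw [Finset.sum_comm]
  refine Finset.sum_congr rfl fun a _ => ?_
  by_cases h : q a = j <;> simp [h]

/-- The polynomial whose value at a matrix `g` is the matrix coefficient `ψ (g ^ ⊗ r • t)`. -/
def coeffPoly : Module.Dual K (TensorSpace K n r) →ₗ[K] TensorSpace K n r →ₗ[K]
    MvPolynomial (Fin n × Fin n) K :=
  LinearMap.mk₂ K (fun ψ t => ∑ p, ∑ q, monomial (pairExponent p q)
      (ψ (tensorBasis K n r p) * (tensorBasis K n r).repr t q))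
    (fun ψ ψ' t => by simp [add_mul, Finset.sum_add_distrib])
    (fun c ψ t => by simp [Finset.smul_sum, smul_monomial, mul_assoc])
    (fun ψ t t' => by simp [mul_add, Finset.sum_add_distrib])
    (fun c ψ t => by simp [Finset.smul_sum, smul_monomial, mul_left_comm])

theorem coeffPoly_apply (ψ : Module.Dual K (TensorSpace K n r)) (t : TensorSpace K n r) :
    coeffPoly ψ t = ∑ p, ∑ q, monomial (pairExponent p q)
      (ψ (tensorBasis K n r p) * (tensorBasis K n r).repr t q) := rfl

theorem coeffPoly_tensorBasis (ψ : Module.Dual K (TensorSpace K n r)) (q : Fin r → Fin n) :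
    coeffPoly ψ (tensorBasis K n r q) =
      ∑ p, monomial (pairExponent p q) (ψ (tensorBasis K n r p)) := by
  rw [coeffPoly_apply]
  refine Finset.sum_congr rfl fun p _ => ?_
  rw [Finset.sum_eq_single q]
  · simp
  · intro q' _ hq
    simp [hq.symm]
  · simp

/-- The Schur algebra is dual to the span of the monomials `pairExponent p q`. When α gives the
matrix entries of x, applying α to a matrix coefficient evaluates it at x; for x a matrix g, α is
evaluation at g. -/
theorem apply_coeffPoly_eq {α : MvPolynomial (Fin n × Fin n) K →ₗ[K] K}
    {x : Module.End K (TensorSpace K n r)}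
    (h : ∀ p q, (tensorBasis K n r).repr (x (tensorBasis K n r q)) p =
      α (monomial (pairExponent p q) 1))
    (ψ : Module.Dual K (TensorSpace K n r)) (t : TensorSpace K n r) :
    α (coeffPoly ψ t) = ψ (x t) := by
  have : α ∘ₗ coeffPoly ψ = ψ ∘ₗ x := by
    refine (tensorBasis K n r).ext fun q => ?_
    rw [LinearMap.comp_apply, coeffPoly_tensorBasis, LinearMap.comp_apply,
      ← (tensorBasis K n r).sum_repr (x (tensorBasis K n r q)), map_sum, map_sum]
    refine Finset.sum_congr rfl fun p _ => ?_
    rw [h, map_smul, smul_eq_mul, ← mul_one (ψ _), ← smul_eq_mul, ← smul_monomial, map_smul,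
      smul_eq_mul, smul_eq_mul, mul_one, mul_comm]
  exact LinearMap.congr_fun this t

/-- Every linear functional on polynomials is given, on matrix coefficients of tensor space, by an
element of the Schur algebra. -/
theorem exists_schurAlgebra_of_dual (α : MvPolynomial (Fin n × Fin n) K →ₗ[K] K) :
    ∃ x : SchurAlgebra K n r, (∀ p q, (tensorBasis K n r).repr (x.1 (tensorBasis K n r q)) p =
      α (monomial (pairExponent p q) 1)) := by
  let x : Module.End K (TensorSpace K n r) := (tensorBasis K n r).constr K fun q =>
    ∑ p, α (monomial (pairExponent p q) 1) • tensorBasis K n r p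
  have hx : ∀ q, x (tensorBasis K n r q) =
      ∑ p, α (monomial (pairExponent p q) 1) • tensorBasis K n r p := fun q =>
    Module.Basis.constr_basis _ _ _ _
  have hmem : x ∈ SchurAlgebra K n r := by
    rw [SchurAlgebra, Subalgebra.mem_centralizer_iff]
    rintro _ ⟨s, rfl⟩
    refine (tensorBasis K n r).ext fun q => ?_
    rw [Module.End.mul_apply, Module.End.mul_apply, hx, LinearEquiv.coe_coe, map_sum,
      placePerm_tensorBasis, hx]
    conv_rhs => rw [← Equiv.sum_comp (Equiv.arrowCongr s (Equiv.refl (Fin n)))]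
    refine Finset.sum_congr rfl fun p _ => ?_
    rw [map_smul, placePerm_tensorBasis, ← pairExponent_comp p q s.symm]
    rfl
  refine ⟨⟨x, hmem⟩, fun p q => ?_⟩
  change (tensorBasis K n r).repr (x (tensorBasis K n r q)) p = _
  rw [hx, Module.Basis.repr_sum_self]

/-- A function on exponents takes prescribed values on the exponents of pairs of multi-indices as
soon as the values are compatible with simultaneous place permutations. -/
theorem exists_dual_monomial_eq (c : (Fin r → Fin n) → (Fin r → Fin n) → K)
    (P : (Fin r → Fin n) → (Fin r → Fin n) → Prop)
    (hc : ∀ p q (s : Equiv.Perm (Fin r)), P (p ∘ s) (q ∘ s) → P p q →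
      c (p ∘ s) (q ∘ s) = c p q) :
    ∃ α : MvPolynomial (Fin n × Fin n) K →ₗ[K] K, ∀ p q, P p q →
      α (monomial (pairExponent p q) 1) = c p q := by
  classical
  let v : (Fin n × Fin n →₀ ℕ) → K := fun m =>
    if h : ∃ pq : (Fin r → Fin n) × (Fin r → Fin n),
      P pq.1 pq.2 ∧ pairExponent pq.1 pq.2 = m then c h.choose.1 h.choose.2 else 0
  refine ⟨(basisMonomials (Fin n × Fin n) K).constr K v, fun p q hP => ?_⟩
  have hb : (basisMonomials (Fin n × Fin n) K).constr K v (monomial (pairExponent p q) 1) =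
      v (pairExponent p q) := by
    rw [← Module.Basis.constr_basis (basisMonomials (Fin n × Fin n) K) K v, coe_basisMonomials]
  have hex : ∃ pq : (Fin r → Fin n) × (Fin r → Fin n),
      P pq.1 pq.2 ∧ pairExponent pq.1 pq.2 = pairExponent p q := ⟨(p, q), hP, rfl⟩
  rw [hb]
  simp only [v]
  rw [dif_pos hex]
  obtain ⟨s, h1, h2⟩ := exists_perm_of_pairExponent_eq hex.choose_spec.2
  have := hc p q s (by rw [h1, h2]; exact hex.choose_spec.1) hP
  rwa [h1, h2] at this

/-- Commuting with place permutations makes the entry of x at (p, q) depend only on the monomial of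
(p, q). -/
theorem exists_dual_of_schurAlgebra (x : SchurAlgebra K n r) :
    ∃ α : MvPolynomial (Fin n × Fin n) K →ₗ[K] K, ∀ ψ t, α (coeffPoly ψ t) = ψ (x.1 t) := by
  obtain ⟨α, hα⟩ := exists_dual_monomial_eq
    (fun p q => (tensorBasis K n r).repr (x.1 (tensorBasis K n r q)) p) (fun _ _ => True) (by
      intro p q s _ _
      have h : tensorBasis K n r (q ∘ s) = placePerm K n r s.symm (tensorBasis K n r q) := by
        rw [placePerm_tensorBasis, Equiv.symm_symm]
      rw [h]
      have h2 := placePerm_smul x s.symm (tensorBasis K n r q)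
      change placePerm K n r s.symm (x.1 _) = x.1 _ at h2
      rw [← h2, tensorBasis_repr_placePerm]
      congr 1
      funext a
      simp)
  exact ⟨α, apply_coeffPoly_eq fun p q => (hα p q trivial).symm⟩

/-! ### Matrices and weight projectors in the Schur algebra -/

/-- The action of a matrix on tensor space, as an element of the Schur algebra. -/
def matrixSchur (r : ℕ) (g : Matrix (Fin n) (Fin n) K) : SchurAlgebra K n r :=
  ⟨PiTensorProduct.map fun _ => Matrix.toLin' g, by
    rw [SchurAlgebra, Subalgebra.mem_centralizer_iff]
    rintro _ ⟨s, rfl⟩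
    exact (PiTensorProduct.map_comp_reindex_eq (fun _ => Matrix.toLin' g) s).symm⟩

theorem matrixSchur_mul (g h : Matrix (Fin n) (Fin n) K) :
    matrixSchur r (g * h) = matrixSchur r g * matrixSchur r h := by
  refine Subtype.ext ?_
  change PiTensorProduct.map (fun _ => Matrix.toLin' (g * h)) =
    PiTensorProduct.map (fun _ => Matrix.toLin' g) ∘ₗ PiTensorProduct.map fun _ => Matrix.toLin' h
  rw [← PiTensorProduct.map_comp, Matrix.toLin'_mul]

theorem matrixSchur_tensorBasis (g : Matrix (Fin n) (Fin n) K) (q : Fin r → Fin n) :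
    (matrixSchur r g).1 (tensorBasis K n r q) =
      PiTensorProduct.tprod K fun a i => g i (q a) := by
  rw [tensorBasis_apply]
  change PiTensorProduct.map (fun _ => Matrix.toLin' g) (PiTensorProduct.tprod K _) = _
  rw [PiTensorProduct.map_tprod]
  congr 1
  funext a i
  simp [Matrix.toLin'_apply]

theorem eval_coeffPoly (g : Matrix (Fin n) (Fin n) K) (ψ : Module.Dual K (TensorSpace K n r))
    (t : TensorSpace K n r) :
    eval (fun v => g v.1 v.2) (coeffPoly ψ t) = ψ ((matrixSchur r g).1 t) := by
  refine apply_coeffPoly_eq (α := (aeval fun v : Fin n × Fin n => g v.1 v.2).toLinearMap)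
    (fun p q => ?_) ψ t
  rw [matrixSchur_tensorBasis, tensorBasis_repr_tprod, pairExponent, monomial_sum_one,
    AlgHom.toLinearMap_apply, map_prod]
  refine Finset.prod_congr rfl fun a _ => ?_
  exact (aeval_X (fun v : Fin n × Fin n => g v.1 v.2) (p a, q a)).symm

/-- The projector onto the weight space of weight `l` in tensor space. -/
def weightProjector (K : Type*) [Field K] {n : ℕ} (r : ℕ) (l : Fin n → ℕ) :
    Module.End K (TensorSpace K n r) :=
  (tensorBasis K n r).constr K fun p =>
    if (∀ i, (Finset.univ.filter fun a => p a = i).card = l i) then tensorBasis K n r p else 0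

theorem weightProjector_tensorBasis (l : Fin n → ℕ) (p : Fin r → Fin n) :
    weightProjector K r l (tensorBasis K n r p) =
      if (∀ i, (Finset.univ.filter fun a => p a = i).card = l i) then tensorBasis K n r p else 0 :=
  Module.Basis.constr_basis _ _ _ _

/-- The projector onto a weight space, as an element of the Schur algebra. -/
def weightSchur (K : Type*) [Field K] {n : ℕ} (r : ℕ) (l : Fin n → ℕ) : SchurAlgebra K n r :=
  ⟨weightProjector K r l, by
    rw [SchurAlgebra, Subalgebra.mem_centralizer_iff]
    rintro _ ⟨s, rfl⟩
    refine (tensorBasis K n r).ext fun p => ?_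
    rw [Module.End.mul_apply, Module.End.mul_apply, LinearEquiv.coe_coe, placePerm_tensorBasis,
      weightProjector_tensorBasis, weightProjector_tensorBasis]
    have h : ∀ i, (Finset.univ.filter fun a => (p ∘ s.symm) a = i).card =
        (Finset.univ.filter fun a => p a = i).card := by
      intro i
      rw [Finset.card_filter, Finset.card_filter]
      exact Equiv.sum_comp s.symm fun a => if p a = i then 1 else 0
    simp only [h]
    split_ifs
    · rw [placePerm_tensorBasis]
    · rw [map_zero]⟩

theorem weightProjector_repr (l : Fin n → ℕ) (t : TensorSpace K n r) (p : Fin r → Fin n)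
    (h : (tensorBasis K n r).repr (weightProjector K r l t) p ≠ 0) (i : Fin n) :
    (Finset.univ.filter fun a => p a = i).card = l i := by
  by_contra hi
  apply h
  have hz : Finsupp.lapply (R := K) p ∘ₗ (tensorBasis K n r).repr.toLinearMap ∘ₗ
      weightProjector K r l = 0 := by
    refine (tensorBasis K n r).ext fun q => ?_
    simp only [LinearMap.comp_apply, weightProjector_tensorBasis, LinearEquiv.coe_coe,
      Finsupp.lapply_apply, LinearMap.zero_apply]
    split_ifs with hq
    · rw [Module.Basis.repr_self, Finsupp.single_eq_of_ne]
      rintro rfl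
      exact hi (hq i)
    · simp
  exact LinearMap.congr_fun hz t

/-- The projection of a polynomial in the entries of the generic matrix onto its component of degree
`l i` in each row `i`. -/
def rowComponent (K : Type*) [Field K] {n : ℕ} (l : Fin n → ℕ) :
    MvPolynomial (Fin n × Fin n) K →ₗ[K] MvPolynomial (Fin n × Fin n) K :=
  weightedHomogeneousComponent (fun v : Fin n × Fin n => (Pi.single v.1 1 : Fin n → ℕ)) l

theorem coeff_rowComponent (l : Fin n → ℕ) (f : MvPolynomial (Fin n × Fin n) K)
    (m : Fin n × Fin n →₀ ℕ) :
    coeff m (rowComponent K l f) = if (∀ i, ∑ j, m (i, j) = l i) then coeff m f else 0 := by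
  classical
  rw [rowComponent, coeff_weightedHomogeneousComponent]
  congr 1
  rw [eq_iff_iff, funext_iff]
  refine forall_congr' fun i => ?_
  rw [Finsupp.weight_apply, Finsupp.sum_fintype _ _ (by simp), Finset.sum_apply,
    Fintype.sum_prod_type, Finset.sum_eq_single i]
  · simp
  · intro a _ ha
    simp [ha.symm]
  · simp

/-- The algebra endomorphism that adds row `i'` to row `i` of the generic matrix. -/
def rowShear (K : Type*) [Field K] {n : ℕ} (i i' : Fin n) :
    MvPolynomial (Fin n × Fin n) K →ₐ[K] MvPolynomial (Fin n × Fin n) K :=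
  aeval fun v => if v.1 = i then X v + X (i', v.2) else X v

theorem coeffPoly_comp_weightSchur (ψ : Module.Dual K (TensorSpace K n r)) (l : Fin n → ℕ)
    (q : Fin r → Fin n) :
    coeffPoly (ψ ∘ₗ (weightSchur K r l).1) (tensorBasis K n r q) =
      rowComponent K l (coeffPoly ψ (tensorBasis K n r q)) := by
  rw [coeffPoly_tensorBasis, coeffPoly_tensorBasis, map_sum]
  refine Finset.sum_congr rfl fun p _ => ?_
  ext m
  rw [coeff_rowComponent, LinearMap.comp_apply]
  change coeff m (monomial _ (ψ (weightProjector K r l _))) = _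
  rw [weightProjector_tensorBasis, coeff_monomial, coeff_monomial]
  by_cases hm : pairExponent p q = m
  · subst hm
    simp only [if_true, sum_pairExponent_row]
    split_ifs
    · rfl
    · rw [map_zero]
  · simp [hm]

theorem eval_rowShear (g : Matrix (Fin n) (Fin n) K) (i i' : Fin n)
    (f : MvPolynomial (Fin n × Fin n) K) :
    eval (fun v => g v.1 v.2) (rowShear K i i' f) =
      eval (fun v => (Matrix.transvection i i' (1 : K) * g) v.1 v.2) f := by
  rw [rowShear, aeval_def, ← coe_eval₂Hom]
  change ((eval fun v : Fin n × Fin n => g v.1 v.2).comp (eval₂Hom _ _)) f = _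
  congr 1
  refine ringHom_ext (fun c => by simp) fun v => ?_
  obtain ⟨a, b⟩ := v
  simp only [RingHom.comp_apply, eval₂Hom_X', eval_X, Matrix.transvection, add_mul, one_mul,
    Matrix.add_apply]
  by_cases h : a = i
  · subst h
    simp
  · simp [h]

theorem eval_columnShear (g : Matrix (Fin n) (Fin n) K) (j j' : Fin n)
    (f : MvPolynomial (Fin n × Fin n) K) :
    eval (fun v => g v.1 v.2) (columnShear K j j' f) =
      eval (fun v => (g * Matrix.transvection j j' (1 : K)) v.1 v.2) f := by
  rw [columnShear, aeval_def, ← coe_eval₂Hom]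
  change ((eval fun v : Fin n × Fin n => g v.1 v.2).comp (eval₂Hom _ _)) f = _
  congr 1
  refine ringHom_ext (fun c => by simp) fun v => ?_
  obtain ⟨a, b⟩ := v
  simp only [RingHom.comp_apply, eval₂Hom_X', eval_X, Matrix.transvection, mul_add, mul_one,
    Matrix.add_apply]
  by_cases h : b = j'
  · subst h
    simp
  · simp [h]

/-- Infinitude of the field enters here, so that identities between matrix coefficients can be
checked at matrices. -/
theorem polynomial_ext_of_matrix [Infinite K] {f g : MvPolynomial (Fin n × Fin n) K}
    (h : ∀ A : Matrix (Fin n) (Fin n) K, eval (fun v => A v.1 v.2) f = eval (fun v => A v.1 v.2) g) :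
    f = g :=
  MvPolynomial.funext fun x => h (Matrix.of fun i j => x (i, j))

theorem coeffPoly_comp_transvection [Infinite K] (ψ : Module.Dual K (TensorSpace K n r))
    (i i' : Fin n) (t : TensorSpace K n r) :
    coeffPoly (ψ ∘ₗ (matrixSchur r (Matrix.transvection i i' (1 : K))).1) t =
      rowShear K i i' (coeffPoly ψ t) := by
  refine polynomial_ext_of_matrix fun g => ?_
  rw [eval_rowShear, eval_coeffPoly, eval_coeffPoly, matrixSchur_mul]
  rfl

end SchurPairing

/-! ### Highest weight vectors and functionals on Weyl modules -/

section HighestWeight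

variable {K : Type*} [Field K] {n r : ℕ}

namespace BoundedPartition

/-- The row of a cell, as an element of `Fin n`. -/
def rowIndex (l : BoundedPartition n r) (a : Fin r) : Fin n := (l.cell a).1

theorem rowIndex_eq_iff (l : BoundedPartition n r) {a b : Fin r} :
    l.rowIndex a = l.rowIndex b ↔ l.row a = l.row b := Fin.ext_iff

theorem card_rowIndex_eq (l : BoundedPartition n r) (i : Fin n) :
    (Finset.univ.filter fun a => l.rowIndex a = i).card = l.parts i := by
  rw [Finset.card_filter, ← Equiv.sum_comp l.cell.symm, Fintype.sum_sigma, Finset.sum_eq_single i]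
  · simp [rowIndex]
  · intro j _ hj
    simp [rowIndex, hj]
  · simp

/-- The number of the cell in row `i` and column `c`. -/
def cellAt (l : BoundedPartition n r) (i : Fin n) (c : ℕ) (h : c < l.parts i) : Fin r :=
  l.cell.symm ⟨i, c, h⟩

theorem rowIndex_cellAt (l : BoundedPartition n r) (i : Fin n) (c : ℕ) (h : c < l.parts i) :
    l.rowIndex (l.cellAt i c h) = i := by
  simp [rowIndex, cellAt]

theorem col_cellAt (l : BoundedPartition n r) (i : Fin n) (c : ℕ) (h : c < l.parts i) :
    l.col (l.cellAt i c h) = c :=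
  congrArg (fun x : l.Cell => (x.2 : ℕ)) (l.cell.apply_symm_apply ⟨i, c, h⟩)

theorem col_lt (l : BoundedPartition n r) (a : Fin r) : l.col a < l.parts (l.rowIndex a) :=
  (l.cell a).2.2

theorem cellAt_col (l : BoundedPartition n r) (a : Fin r) :
    l.cellAt (l.rowIndex a) (l.col a) (l.col_lt a) = a := by
  simp [rowIndex, col, cellAt]

end BoundedPartition

/-- The tensor of standard basis vectors that has `e i` in all the cells of row `i`. -/
def rowTensor (K : Type*) [Field K] (l : BoundedPartition n r) : TensorSpace K n r :=
  tensorBasis K n r l.rowIndex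

theorem rowTensor_mem (l : BoundedPartition n r) :
    rowTensor K l ∈ DividedPowerModule (K := K) l := by
  intro s hs
  rw [rowTensor, placePerm_tensorBasis]
  congr 1
  funext a
  rw [Function.comp_apply, l.rowIndex_eq_iff, ← hs (s.symm a), Equiv.apply_symm_apply]

/-- The highest weight vector of the Weyl module. -/
def highestWeightVector (K : Type*) [Field K] (l : BoundedPartition n r) : WeylModule K l :=
  ⟨weylMap K l ⟨rowTensor K l, rowTensor_mem l⟩, LinearMap.mem_range_self _ _⟩

/-- A tensor t symmetric along rows is x applied to the row tensor when the entry of x at (p,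
`l.rowIndex`) is the coefficient of t at p. The monomial of this pair determines p up to
permutations within the rows, which do not change the coefficient, so such an x exists. -/
theorem exists_smul_highestWeightVector (l : BoundedPartition n r) (w : WeylModule K l) :
    ∃ x : SchurAlgebra K n r, x • highestWeightVector K l = w := by
  obtain ⟨_, ⟨⟨t, ht⟩, rfl⟩⟩ := w
  obtain ⟨α, hα⟩ := exists_dual_monomial_eq (fun p _ => (tensorBasis K n r).repr t p)
    (fun _ q => q = l.rowIndex) (by
      intro p q s hs hq
      rw [← tensorBasis_repr_placePerm, ht s fun a => ?_]
      subst hq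
      rw [← l.rowIndex_eq_iff]
      exact congrFun hs a)
  obtain ⟨x, hx⟩ := exists_schurAlgebra_of_dual (n := n) (r := r) α
  have hxt : x.1 (rowTensor K l) = t := by
    refine (tensorBasis K n r).ext_elem fun p => ?_
    rw [rowTensor, hx, hα p _ rfl]
  refine ⟨x, Subtype.ext ?_⟩
  change (columnSubmodule (K := K) l).mkQ (x.1 (rowTensor K l)) = (columnSubmodule (K := K) l).mkQ t
  rw [hxt]

/-- The pairing of the Weyl module with the functionals on tensor space that vanish on the column
relations. -/
def weylPairing (K : Type*) [Field K] (l : BoundedPartition n r) :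
    WeylModule K l →ₗ[K] Module.Dual K (columnRelations (K := K) l).dualAnnihilator :=
  ((columnRelations (K := K) l).dualCopairing.flip ∘ₗ
    (Submodule.Quotient.restrictScalarsEquiv K (columnSubmodule (K := K) l)).symm.toLinearMap) ∘ₗ
  ({ toFun := fun w => w.1
     map_add' := fun _ _ => rfl
     map_smul' := fun _ _ => rfl } : WeylModule K l →ₗ[K] ColumnExteriorModule K l)

theorem weylPairing_smul (l : BoundedPartition n r) (x : SchurAlgebra K n r)
    (ψ : (columnRelations (K := K) l).dualAnnihilator) :
    weylPairing K l (x • highestWeightVector K l) ψ = ψ.1 (x.1 (rowTensor K l)) := rfl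

/-- Over a field a subspace is cut out by the functionals that vanish on it. Equations in the Weyl
module can thus be tested on these functionals. -/
theorem weylPairing_injective (l : BoundedPartition n r) :
    Function.Injective (weylPairing K l) := by
  rw [injective_iff_map_eq_zero]
  intro w hw
  obtain ⟨x, rfl⟩ := exists_smul_highestWeightVector l w
  have h : x.1 (rowTensor K l) ∈ columnRelations (K := K) l := by
    rw [← Subspace.dualAnnihilator_dualCoannihilator_eq (W := columnRelations (K := K) l),
      Submodule.mem_dualCoannihilator]
    intro ψ hψ
    exact LinearMap.congr_fun hw ⟨ψ, hψ⟩
  refine Subtype.ext ?_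
  exact (Submodule.Quotient.mk_eq_zero (columnSubmodule (K := K) l)).2 h

/-- The Schur algebra acts on the functionals that vanish on the column relations. -/
def annihilatorComp (l : BoundedPartition n r) (x : SchurAlgebra K n r)
    (ψ : (columnRelations (K := K) l).dualAnnihilator) :
    (columnRelations (K := K) l).dualAnnihilator :=
  ⟨ψ.1 ∘ₗ x.1, (Submodule.mem_dualAnnihilator _).2 fun _ ht =>
    (Submodule.mem_dualAnnihilator _).1 ψ.2 _ (smul_mem_columnRelations l x ht)⟩

theorem weylPairing_annihilatorComp (l : BoundedPartition n r) (x : SchurAlgebra K n r)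
    (w : WeylModule K l) (ψ : (columnRelations (K := K) l).dualAnnihilator) :
    weylPairing K l (x • w) ψ = weylPairing K l w (annihilatorComp l x ψ) := by
  obtain ⟨y, rfl⟩ := exists_smul_highestWeightVector l w
  rw [smul_smul, weylPairing_smul, weylPairing_smul]
  rfl

theorem weightSchur_smul_highestWeightVector (l : BoundedPartition n r) :
    weightSchur K r l.parts • highestWeightVector K l = highestWeightVector K l := by
  apply weylPairing_injective
  ext ψ
  rw [← one_smul (SchurAlgebra K n r) (highestWeightVector K l), smul_smul, mul_one,
    weylPairing_smul, weylPairing_smul]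
  change ψ.1 (weightProjector K r l.parts (rowTensor K l)) = ψ.1 (rowTensor K l)
  rw [rowTensor, weightProjector_tensorBasis, if_pos l.card_rowIndex_eq]

/-- In the multilinear expansion, a term with e j placed in a cell of row j' has a second e j in the
same column, in row j, so it is a column relation. That cell of row j exists because row j is at
least as long as row j'. -/
theorem tprod_add_sub_rowTensor_mem (l : BoundedPartition n r) {j j' : Fin n} (hj : j < j')
    (S : Finset (Fin r)) (hS : ∀ a ∈ S, l.rowIndex a = j') :
    (PiTensorProduct.tprod K fun a => Pi.single (l.rowIndex a) (1 : K) +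
      if a ∈ S then Pi.single j (1 : K) else 0) - rowTensor K l ∈ columnRelations (K := K) l := by
  induction S using Finset.induction_on with
  | empty => simp [rowTensor, tensorBasis_apply]
  | insert a S ha ih =>
    let v : Fin r → Fin n → K := fun b => Pi.single (l.rowIndex b) (1 : K) +
      if b ∈ S then Pi.single j (1 : K) else 0
    have ha' : l.rowIndex a = j' := hS a (by simp)
    have hv : (fun b => Pi.single (l.rowIndex b) (1 : K) +
        if b ∈ insert a S then Pi.single j (1 : K) else 0) =
        Function.update v a (v a + Pi.single j (1 : K)) := by
      funext b
      by_cases hb : b = a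
      · subst hb
        simp [v, ha]
      · simp [v, hb]
    have hlt : l.col a < l.parts j :=
      (l.col_lt a).trans_le (by rw [ha']; exact l.antitone' hj.le)
    have hrow := l.rowIndex_cellAt j (l.col a) hlt
    have hne : l.cellAt j (l.col a) hlt ≠ a := by
      intro h
      rw [h, ha'] at hrow
      exact hj.ne' hrow
    have hnot : l.cellAt j (l.col a) hlt ∉ S := by
      intro h
      have := hS _ (Finset.mem_insert_of_mem h)
      rw [hrow] at this
      exact hj.ne this
    rw [hv, MultilinearMap.map_update_add, Function.update_eq_self, add_sub_right_comm]
    refine Submodule.add_mem _ (ih fun b hb => hS b (by simp [hb])) ?_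
    refine Submodule.subset_span ⟨_, a, l.cellAt j (l.col a) hlt, hne.symm, ?_, ?_, rfl⟩
    · rw [l.col_cellAt]
    · rw [Function.update_self, Function.update_of_ne hne]
      simp [v, hrow, hnot]

theorem transvection_smul_highestWeightVector (l : BoundedPartition n r) {j j' : Fin n}
    (hj : j < j') :
    matrixSchur r (Matrix.transvection j j' (1 : K)) • highestWeightVector K l =
      highestWeightVector K l := by
  apply weylPairing_injective
  ext ψ
  rw [← one_smul (SchurAlgebra K n r) (highestWeightVector K l), smul_smul, mul_one,
    weylPairing_smul, weylPairing_smul]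
  have h := tprod_add_sub_rowTensor_mem (K := K) l hj
    (Finset.univ.filter fun a => l.rowIndex a = j') (by simp)
  have h2 : (matrixSchur r (Matrix.transvection j j' (1 : K))).1 (rowTensor K l) =
      PiTensorProduct.tprod K fun a => Pi.single (l.rowIndex a) (1 : K) +
        if a ∈ Finset.univ.filter (fun a => l.rowIndex a = j') then Pi.single j (1 : K)
          else 0 := by
    rw [rowTensor, matrixSchur_tensorBasis]
    congr 1
    funext a i
    simp only [Matrix.transvection, Matrix.add_apply, Matrix.one_apply, Matrix.single_apply,
      Finset.mem_filter, Finset.mem_univ, true_and, Pi.add_apply, Pi.single_apply]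
    by_cases h : l.rowIndex a = j'
    · simp [h, Pi.single_apply, eq_comm]
    · simp [h, Ne.symm h]
  rw [h2, ← sub_eq_zero]
  refine Eq.trans (map_sub ψ.1 _ _).symm ?_
  exact (Submodule.mem_dualAnnihilator _).1 ψ.2 _ h

/-! ### Matrix coefficients of the Weyl module are the invariants of column operations -/

/-- The multilinear form on tensor space that is the product of determinants given by the rows `I`
in each column of the diagram. -/
def columnDetForm (K : Type*) [Field K] (l : BoundedPartition n r) (N : ℕ)
    (I : (c : ℕ) → (Finset.univ.filter fun j => c < l.parts j : Finset (Fin n)) → Fin n)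
    (hN : ∀ j, l.parts j ≤ N) :
    MultilinearMap K (fun _ : Fin r => (Fin n → K)) K :=
  let M : (Fin r → Fin n → K) → (c : ℕ) →
      Matrix (Finset.univ.filter fun j => c < l.parts j : Finset (Fin n))
        (Finset.univ.filter fun j => c < l.parts j : Finset (Fin n)) K :=
    fun v c => Matrix.of fun a b => v (l.cellAt b c (Finset.mem_filter.1 b.2).2) (I c a)
  -- Changing the vector in one cell changes a single column of a single determinant, whence
  -- multilinearity.
  have hne : ∀ (v : Fin r → Fin n → K) (a : Fin r) (x : Fin n → K) (c : ℕ), c ≠ l.col a →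
      M (Function.update v a x) c = M v c := by
    intro v a x c hc
    ext i b
    simp only [M, Matrix.of_apply]
    rw [Function.update_of_ne]
    rintro rfl
    exact hc (l.col_cellAt _ _ _).symm
  have heq : ∀ (v : Fin r → Fin n → K) (a : Fin r) (x : Fin n → K),
      M (Function.update v a x) (l.col a) = (M v (l.col a)).updateCol
        ⟨l.rowIndex a, Finset.mem_filter.2 ⟨Finset.mem_univ _, l.col_lt a⟩⟩
        (fun i => x (I (l.col a) i)) := by
    intro v a x
    ext i b
    rw [Matrix.updateCol_apply]
    simp only [M, Matrix.of_apply]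
    split_ifs with hb
    · subst hb
      rw [l.cellAt_col, Function.update_self]
    · rw [Function.update_of_ne]
      intro h
      apply hb
      exact Subtype.ext ((l.rowIndex_cellAt _ _ _).symm.trans (congrArg l.rowIndex h))
  have hprod : ∀ (v : Fin r → Fin n → K) (a : Fin r) (x : Fin n → K),
      ∏ c ∈ Finset.range N, (M (Function.update v a x) c).det =
        (M (Function.update v a x) (l.col a)).det *
          ∏ c ∈ (Finset.range N).erase (l.col a), (M v c).det := by
    intro v a x
    rw [← Finset.mul_prod_erase _ _ (Finset.mem_range.2 ((l.col_lt a).trans_le (hN _)))]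
    congr 1
    exact Finset.prod_congr rfl fun c hc => by rw [hne v a x c (Finset.ne_of_mem_erase hc)]
  { toFun := fun v => ∏ c ∈ Finset.range N, (M v c).det
    map_update_add' := by
      intro hdec v a x y
      rw [Subsingleton.elim hdec (instDecidableEqFin r)]
      rw [hprod, hprod, hprod, heq, heq, heq, ← add_mul]
      congr 1
      exact Matrix.det_updateCol_add _ _ _ _
    map_update_smul' := by
      intro hdec v a c x
      rw [Subsingleton.elim hdec (instDecidableEqFin r)]
      rw [hprod, hprod, heq, heq, smul_eq_mul, ← mul_assoc]
      congr 1
      exact Matrix.det_updateCol_smul _ _ _ _ }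

theorem columnDetForm_apply (l : BoundedPartition n r) (N : ℕ)
    (I : (c : ℕ) → (Finset.univ.filter fun j => c < l.parts j : Finset (Fin n)) → Fin n)
    (hN : ∀ j, l.parts j ≤ N) (v : Fin r → Fin n → K) :
    columnDetForm K l N I hN v = ∏ c ∈ Finset.range N, Matrix.det (Matrix.of fun
      a b : (Finset.univ.filter fun j => c < l.parts j : Finset (Fin n)) =>
        v (l.cellAt b c (Finset.mem_filter.1 b.2).2) (I c a)) := rfl

theorem lift_columnDetForm_mem (l : BoundedPartition n r) (N : ℕ)
    (I : (c : ℕ) → (Finset.univ.filter fun j => c < l.parts j : Finset (Fin n)) → Fin n)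
    (hN : ∀ j, l.parts j ≤ N) :
    PiTensorProduct.lift (columnDetForm K l N I hN) ∈
      (columnRelations (K := K) l).dualAnnihilator := by
  rw [Submodule.mem_dualAnnihilator]
  suffices h : columnRelations (K := K) l ≤
      LinearMap.ker (PiTensorProduct.lift (columnDetForm K l N I hN)) from
    fun _ ht => h ht
  refine Submodule.span_le.2 ?_
  rintro _ ⟨v, a, b, hab, hc, hv, rfl⟩
  rw [SetLike.mem_coe, LinearMap.mem_ker, PiTensorProduct.lift.tprod, columnDetForm_apply]
  refine Finset.prod_eq_zero (Finset.mem_range.2 ((l.col_lt a).trans_le (hN _))) ?_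
  have hb : l.col a < l.parts (l.rowIndex b) := hc ▸ l.col_lt b
  have hbc : l.cellAt (l.rowIndex b) (l.col a) hb = b := by
    conv_rhs => rw [← l.cellAt_col b]
    congr 1
  refine Matrix.det_zero_of_column_eq
    (i := ⟨l.rowIndex a, Finset.mem_filter.2 ⟨Finset.mem_univ _, l.col_lt a⟩⟩)
    (j := ⟨l.rowIndex b, Finset.mem_filter.2 ⟨Finset.mem_univ _, hb⟩⟩) ?_ ?_
  · intro h
    apply hab
    rw [← l.cellAt_col a, ← hbc]
    congr 1
    exact congrArg Subtype.val h
  · intro i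
    simp only [Matrix.of_apply]
    rw [l.cellAt_col, hbc, hv]

/-- Evaluated on g applied to the row tensor, the form `columnDetForm` is the corresponding product
of minors of g. -/
theorem minorProductSpan_le_map_coeffPoly [Infinite K] (l : BoundedPartition n r) {N : ℕ}
    (hN : ∀ j, l.parts j ≤ N) :
    minorProductSpan K l.parts N ≤
      (columnRelations (K := K) l).dualAnnihilator.map (coeffPoly.flip (rowTensor K l)) := by
  rw [minorProductSpan_eq_span, Submodule.span_le]
  rintro _ ⟨I, rfl⟩
  refine ⟨_, lift_columnDetForm_mem l N I hN, polynomial_ext_of_matrix fun g => ?_⟩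
  rw [LinearMap.flip_apply, eval_coeffPoly, rowTensor, matrixSchur_tensorBasis,
    PiTensorProduct.lift.tprod, columnDetForm_apply, map_prod]
  refine Finset.prod_congr rfl fun c _ => ?_
  rw [RingHom.map_det]
  congr 1
  ext a b
  simp [l.rowIndex_cellAt]

/-- Matrix coefficients of vectors of weight `l` that are fixed by simple transvections are
invariants of column operations. -/
theorem coeffPoly_mem_columnInvariants [Infinite K] (l : BoundedPartition n r)
    (m : BoundedPartition n r) (ψ : (columnRelations (K := K) m).dualAnnihilator)
    (t : TensorSpace K n r) (ht : weightProjector K r l.parts t = t)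
    (hfix : ∀ (j j' : Fin n), (j' : ℕ) = j + 1 →
      ∀ ψ : (columnRelations (K := K) m).dualAnnihilator,
      ψ.1 ((matrixSchur r (Matrix.transvection j j' (1 : K))).1 t) = ψ.1 t) :
    coeffPoly ψ.1 t ∈ columnInvariants K l.parts := by
  refine ⟨fun d hd j => ?_, fun j j' hj => polynomial_ext_of_matrix fun g => ?_⟩
  · rw [coeffPoly_apply, coeff_sum] at hd
    obtain ⟨p, _, hp⟩ := Finset.exists_ne_zero_of_sum_ne_zero hd
    rw [coeff_sum] at hp
    obtain ⟨q, _, hq⟩ := Finset.exists_ne_zero_of_sum_ne_zero hp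
    rw [coeff_monomial, ite_ne_right_iff] at hq
    rw [← hq.1, sum_pairExponent_column]
    refine weightProjector_repr l.parts t q ?_ j
    rw [ht]
    exact right_ne_zero_of_mul hq.2
  · rw [eval_columnShear, eval_coeffPoly, eval_coeffPoly, matrixSchur_mul]
    -- Composing ψ with g again gives a functional that vanishes on the column relations, so `hfix`
    -- applies at every g.
    exact hfix j j' hj (annihilatorComp m (matrixSchur r g) ψ)

theorem map_coeffPoly_le_columnInvariants [Infinite K] (l : BoundedPartition n r) :
    (columnRelations (K := K) l).dualAnnihilator.map (coeffPoly.flip (rowTensor K l)) ≤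
      columnInvariants K l.parts := by
  rintro _ ⟨ψ, hψ, rfl⟩
  refine coeffPoly_mem_columnInvariants l l ⟨ψ, hψ⟩ (rowTensor K l) ?_ fun j j' hj ψ => ?_
  · rw [rowTensor, weightProjector_tensorBasis, if_pos l.card_rowIndex_eq]
  · have h := congrArg (fun w => weylPairing K l w ψ)
      (transvection_smul_highestWeightVector (K := K) l
        (show j < j' from Fin.lt_def.2 (by omega)))
    rw [weylPairing_smul, ← one_smul (SchurAlgebra K n r) (highestWeightVector K l),
      weylPairing_smul] at h
    exact h

/-- Products of minors are matrix coefficients of the highest weight vector, and these are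
invariants. This proves that products of minors are invariant, as the leading monomial argument
requires. -/
theorem columnInvariants_eq_minorProductSpan [Infinite K] (l : BoundedPartition n r) {N : ℕ}
    (hN : ∀ j, l.parts j ≤ N) : columnInvariants K l.parts = minorProductSpan K l.parts N :=
  le_antisymm (columnInvariants_le_minorProductSpan l.antitone' hN
    ((minorProductSpan_le_map_coeffPoly l hN).trans (map_coeffPoly_le_columnInvariants l)))
    ((minorProductSpan_le_map_coeffPoly l hN).trans (map_coeffPoly_le_columnInvariants l))

theorem columnInvariants_eq_map_coeffPoly [Infinite K] (l : BoundedPartition n r) :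
    columnInvariants K l.parts =
      (columnRelations (K := K) l).dualAnnihilator.map (coeffPoly.flip (rowTensor K l)) := by
  refine le_antisymm ?_ (map_coeffPoly_le_columnInvariants l)
  have hN : ∀ j, l.parts j ≤ r := fun j =>
    (Finset.single_le_sum (fun i _ => Nat.zero_le (l.parts i)) (Finset.mem_univ j)).trans
      l.sum_eq'.le
  rw [columnInvariants_eq_minorProductSpan l hN]
  exact minorProductSpan_le_map_coeffPoly l hN

end HighestWeight

/-! ### Homomorphisms between Weyl modules as linear forms on polynomials -/

section WeylHomForms

variable {K : Type*} [Field K] {n r : ℕ}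

/-- The linear forms on the invariants of column operations of degrees `m` that vanish outside row
degrees `l` and that are invariant under the addition of a row to the preceding one. -/
def weylHomForms (K : Type*) [Field K] {n : ℕ} (l m : Fin n → ℕ) :
    Submodule K (Module.Dual K (columnInvariants K m)) where
  carrier := {θ | (∀ f g : columnInvariants K m, g.1 = rowComponent K l f.1 → θ g = θ f) ∧
    ∀ (i i' : Fin n), (i' : ℕ) = i + 1 →
      ∀ f g : columnInvariants K m, g.1 = rowShear K i i' f.1 → θ g = θ f}
  add_mem' := by
    rintro θ θ' ⟨h1, h2⟩ ⟨h1', h2'⟩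
    refine ⟨fun f g h => ?_, fun i i' hi f g h => ?_⟩
    · rw [LinearMap.add_apply, LinearMap.add_apply, h1 f g h, h1' f g h]
    · rw [LinearMap.add_apply, LinearMap.add_apply, h2 i i' hi f g h, h2' i i' hi f g h]
  zero_mem' := ⟨fun _ _ _ => rfl, fun _ _ _ _ _ _ => rfl⟩
  smul_mem' := by
    rintro c θ ⟨h1, h2⟩
    refine ⟨fun f g h => ?_, fun i i' hi f g h => ?_⟩
    · rw [LinearMap.smul_apply, LinearMap.smul_apply, h1 f g h]
    · rw [LinearMap.smul_apply, LinearMap.smul_apply, h2 i i' hi f g h]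

/-- The universal property of Weyl modules, for maps to a Weyl module. -/
theorem exists_weylHom [Infinite K] (l m : BoundedPartition n r) (w : WeylModule K m)
    (hw : weightSchur K r l.parts • w = w)
    (hfix : ∀ (j j' : Fin n), (j' : ℕ) = j + 1 →
      matrixSchur r (Matrix.transvection j j' (1 : K)) • w = w) :
    ∃ φ : WeylHom K l m, φ (highestWeightVector K l) = w := by
  have hker : LinearMap.ker (LinearMap.toSpanSingleton (SchurAlgebra K n r) _
      (highestWeightVector K l)) ≤
      LinearMap.ker (LinearMap.toSpanSingleton (SchurAlgebra K n r) _ w) := by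
    intro x hx
    rw [LinearMap.mem_ker, LinearMap.toSpanSingleton_apply] at hx ⊢
    obtain ⟨y, rfl⟩ := exists_smul_highestWeightVector m w
    apply weylPairing_injective
    ext ψ
    have hidem : weightProjector K r l.parts (weightProjector K r l.parts (y.1 (rowTensor K m))) =
        weightProjector K r l.parts (y.1 (rowTensor K m)) := by
      rw [← LinearMap.comp_apply]
      congr 1
      refine (tensorBasis K n r).ext fun p => ?_
      rw [LinearMap.comp_apply, weightProjector_tensorBasis]
      split_ifs with h
      · rw [weightProjector_tensorBasis, if_pos h]
      · rw [map_zero]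
    have hinv := coeffPoly_mem_columnInvariants l m ψ _ hidem (by
      intro j j' hj ψ
      have h := congrArg (fun v => weylPairing K m v ψ) (hfix j j' hj)
      rw [← hw, smul_smul, smul_smul, weylPairing_smul, smul_smul, weylPairing_smul] at h
      exact h)
    -- The coefficient of w against ψ is an invariant for `l`, hence a coefficient of the highest
    -- weight vector of Δ(l) against some ψ'. An x that kills that vector therefore kills w.
    rw [columnInvariants_eq_map_coeffPoly] at hinv
    obtain ⟨ψ', hψ', h⟩ := hinv
    obtain ⟨α, hα⟩ := exists_dual_of_schurAlgebra x
    have h1 := congrArg α h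
    rw [LinearMap.flip_apply, hα, hα] at h1
    have h2 := weylPairing_smul l x ⟨ψ', hψ'⟩
    rw [hx, map_zero] at h2
    rw [← hw, smul_smul, smul_smul, weylPairing_smul, map_zero]
    exact h1.symm.trans h2.symm
  have hsurj : Function.Surjective (LinearMap.toSpanSingleton (SchurAlgebra K n r) _
      (highestWeightVector K l)) := exists_smul_highestWeightVector l
  refine ⟨(Submodule.liftQ _ (LinearMap.toSpanSingleton (SchurAlgebra K n r) _ w) hker) ∘ₗ
    (LinearMap.quotKerEquivOfSurjective _ hsurj).symm.toLinearMap, ?_⟩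
  have h1 : (LinearMap.quotKerEquivOfSurjective _ hsurj).symm (highestWeightVector K l) =
      Submodule.Quotient.mk 1 := by
    rw [LinearEquiv.symm_apply_eq]
    exact (one_smul (SchurAlgebra K n r) (highestWeightVector K l)).symm
  rw [LinearMap.comp_apply, LinearEquiv.coe_coe, h1]
  exact one_smul (SchurAlgebra K n r) w

/-- The matrix coefficients of the highest weight vector of a Weyl module. -/
def highestWeightCoeff [Infinite K] (m : BoundedPartition n r) :
    (columnRelations (K := K) m).dualAnnihilator →ₗ[K] columnInvariants K m.parts :=
  (coeffPoly.flip (rowTensor K m) ∘ₗ Submodule.subtype _).codRestrict _ fun ψ =>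
    map_coeffPoly_le_columnInvariants m ⟨ψ.1, ψ.2, rfl⟩

theorem highestWeightCoeff_coe [Infinite K] (m : BoundedPartition n r)
    (ψ : (columnRelations (K := K) m).dualAnnihilator) :
    (highestWeightCoeff m ψ).1 = coeffPoly ψ.1 (rowTensor K m) := rfl

theorem highestWeightCoeff_surjective [Infinite K] (m : BoundedPartition n r) :
    Function.Surjective (highestWeightCoeff (K := K) m) := by
  rintro ⟨f, hf⟩
  rw [columnInvariants_eq_map_coeffPoly] at hf
  obtain ⟨ψ, hψ, rfl⟩ := hf
  exact ⟨⟨ψ, hψ⟩, rfl⟩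

theorem rowComponent_highestWeightCoeff [Infinite K] (m : BoundedPartition n r) (l : Fin n → ℕ)
    (ψ : (columnRelations (K := K) m).dualAnnihilator) :
    (highestWeightCoeff m (annihilatorComp m (weightSchur K r l) ψ)).1 =
      rowComponent K l (highestWeightCoeff m ψ).1 :=
  coeffPoly_comp_weightSchur ψ.1 l m.rowIndex

theorem rowShear_highestWeightCoeff [Infinite K] (m : BoundedPartition n r) (i i' : Fin n)
    (ψ : (columnRelations (K := K) m).dualAnnihilator) :
    (highestWeightCoeff m (annihilatorComp m
      (matrixSchur r (Matrix.transvection i i' (1 : K))) ψ)).1 =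
      rowShear K i i' (highestWeightCoeff m ψ).1 :=
  coeffPoly_comp_transvection ψ.1 i i' (rowTensor K m)

/-- Invariants are matrix coefficients, and taking a row component amounts to composing the
functional with a weight projector. -/
theorem rowComponent_mem_columnInvariants [Infinite K] (m : BoundedPartition n r) (l : Fin n → ℕ)
    {f : MvPolynomial (Fin n × Fin n) K} (hf : f ∈ columnInvariants K m.parts) :
    rowComponent K l f ∈ columnInvariants K m.parts := by
  obtain ⟨ψ, hψ⟩ := highestWeightCoeff_surjective m ⟨f, hf⟩
  have h := rowComponent_highestWeightCoeff m l ψ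
  rw [hψ] at h
  rw [← h]
  exact Subtype.property _

theorem rowShear_mem_columnInvariants [Infinite K] (m : BoundedPartition n r) (i i' : Fin n)
    {f : MvPolynomial (Fin n × Fin n) K} (hf : f ∈ columnInvariants K m.parts) :
    rowShear K i i' f ∈ columnInvariants K m.parts := by
  obtain ⟨ψ, hψ⟩ := highestWeightCoeff_surjective m ⟨f, hf⟩
  have h := rowShear_highestWeightCoeff m i i' ψ
  rw [hψ] at h
  rw [← h]
  exact Subtype.property _

/-- The linear form on functionals given by the image of the highest weight vector. -/
def weylHomPairing (K : Type*) [Field K] (l m : BoundedPartition n r) :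
    WeylHom K l m →ₗ[K] Module.Dual K (columnRelations (K := K) m).dualAnnihilator where
  toFun φ := weylPairing K m (φ (highestWeightVector K l))
  map_add' φ φ' := by rw [LinearMap.add_apply, map_add]
  map_smul' c φ := by rw [LinearMap.smul_apply, map_smul, RingHom.id_apply]

theorem weylHomPairing_injective (l m : BoundedPartition n r) :
    Function.Injective (weylHomPairing K l m) := by
  intro φ φ' h
  have h' := weylPairing_injective m h
  refine LinearMap.ext fun w => ?_
  obtain ⟨x, rfl⟩ := exists_smul_highestWeightVector l w
  rw [map_smul, map_smul, h']

/-- A homomorphism is determined by the image of the highest weight vector. The two conditions on a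
form say that this image has weight `l` and is fixed by the simple transvections. Conversely, a form
extends to all polynomials, hence comes from an element of the Schur algebra, and the universal
property yields the homomorphism. -/
theorem range_weylHomPairing [Infinite K] (l m : BoundedPartition n r) :
    LinearMap.range (weylHomPairing K l m) =
      (weylHomForms K l.parts m.parts).map (highestWeightCoeff m).dualMap := by
  apply le_antisymm
  · rintro _ ⟨φ, rfl⟩
    obtain ⟨y, hy⟩ := exists_smul_highestWeightVector m (φ (highestWeightVector K l))
    obtain ⟨α, hα⟩ := exists_dual_of_schurAlgebra y
    have hpair : ∀ ψ, α (highestWeightCoeff m ψ).1 =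
        weylPairing K m (φ (highestWeightVector K l)) ψ := by
      intro ψ
      rw [← hy, weylPairing_smul, highestWeightCoeff_coe, hα]
    refine ⟨α ∘ₗ Submodule.subtype _, ⟨fun f g hg => ?_, fun i i' hi f g hg => ?_⟩, ?_⟩
    · obtain ⟨ψ, rfl⟩ := highestWeightCoeff_surjective m f
      rw [← rowComponent_highestWeightCoeff] at hg
      change α g.1 = α (highestWeightCoeff m ψ).1
      rw [hg, hpair, hpair, ← weylPairing_annihilatorComp, ← map_smul,
        weightSchur_smul_highestWeightVector]
    · obtain ⟨ψ, rfl⟩ := highestWeightCoeff_surjective m f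
      rw [← rowShear_highestWeightCoeff] at hg
      change α g.1 = α (highestWeightCoeff m ψ).1
      rw [hg, hpair, hpair, ← weylPairing_annihilatorComp, ← map_smul,
        transvection_smul_highestWeightVector l (Fin.lt_def.2 (by omega))]
    · ext ψ
      exact hpair ψ
  · rintro _ ⟨θ, hθ, rfl⟩
    obtain ⟨α, hα⟩ := θ.exists_extend
    obtain ⟨y, hy⟩ := exists_schurAlgebra_of_dual (n := n) (r := r) α
    have hpair : ∀ ψ, weylPairing K m (y • highestWeightVector K m) ψ =
        θ (highestWeightCoeff m ψ) := by
      intro ψ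
      rw [weylPairing_smul, ← apply_coeffPoly_eq hy, ← hα]
      rfl
    obtain ⟨φ, hφ⟩ := exists_weylHom l m (y • highestWeightVector K m) (by
        apply weylPairing_injective
        ext ψ
        rw [weylPairing_annihilatorComp, hpair, hpair]
        exact hθ.1 _ _ (rowComponent_highestWeightCoeff m l.parts ψ)) (by
        intro j j' hj
        apply weylPairing_injective
        ext ψ
        rw [weylPairing_annihilatorComp, hpair, hpair]
        exact hθ.2 j j' hj _ _ (rowShear_highestWeightCoeff m j j' ψ))
    refine ⟨φ, ?_⟩
    ext ψ
    exact (congrArg (fun w => weylPairing K m w ψ) hφ).trans (hpair ψ)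

theorem rank_weylHom [Infinite K] (l m : BoundedPartition n r) :
    Module.rank K (WeylHom K l m) = Module.rank K (weylHomForms K l.parts m.parts) := by
  have hinj : Function.Injective (highestWeightCoeff (K := K) m).dualMap :=
    LinearMap.dualMap_injective_of_surjective (highestWeightCoeff_surjective m)
  rw [(LinearEquiv.ofInjective _ (weylHomPairing_injective l m)).rank_eq, range_weylHomPairing,
    (Submodule.equivMapOfInjective _ hinj (weylHomForms K l.parts m.parts)).rank_eq]

end WeylHomForms

/-! ### Adding cells to the first row -/

section AddFirst

variable {K : Type*} [Field K] {n r : ℕ}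

/-- Intended for x and y that are p^d-th powers of variables, with q = p^d. The saving of q in the
weight of c is what the bound on μ₁ - λ₁ needs. -/
theorem exists_add_pow_eq_add_mul {w : Fin n × Fin n → ℤ} {q : ℤ}
    {x y : MvPolynomial (Fin n × Fin n) K} (hx : x ∈ weightLE K w q) (hy : y ∈ weightLE K w q)
    (k : ℕ) : ∃ c ∈ weightLE K w (k * q - q), (x + y) ^ k = x ^ k + y * c := by
  induction k with
  | zero => exact ⟨0, Submodule.zero_mem _, by simp⟩
  | succ k ih =>
    obtain ⟨c, hc, h⟩ := ih
    refine ⟨x ^ k + c * (x + y), Submodule.add_mem _ ?_ ?_, ?_⟩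
    · exact weightLE_mono _ (by push_cast; linarith) (pow_mem_weightLE hx k)
    · exact mul_mem_weightLE hc (Submodule.add_mem _ hx hy) (by push_cast; linarith)
    · rw [pow_succ, h]
      ring

/-- The weight for which the weight of a monomial is its degree in the first row of the generic
matrix. -/
def firstRowWeight (n : ℕ) [NeZero n] (v : Fin n × Fin n) : ℤ := if v.1 = 0 then 1 else 0

theorem weight_firstRowWeight [NeZero n] (m : Fin n × Fin n →₀ ℕ) :
    Finsupp.weight (firstRowWeight n) m = (∑ j, m (0, j) : ℕ) := by
  rw [weight_eq_sum_univ, Fintype.sum_prod_type, Finset.sum_eq_single 0]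
  · simp [firstRowWeight]
  · intro i _ hi
    simp [firstRowWeight, hi]
  · simp

theorem rowComponent_eq_zero [NeZero n] {l : Fin n → ℕ} {k : ℤ} (hk : k < l 0)
    {f : MvPolynomial (Fin n × Fin n) K} (hf : f ∈ weightLE K (firstRowWeight n) k) :
    rowComponent K l f = 0 := by
  ext m
  rw [coeff_rowComponent, coeff_zero]
  split_ifs with h
  · refine coeff_eq_zero_of_mem_weightLE hf ?_
    rw [weight_firstRowWeight, h 0]
    exact hk
  · rfl

theorem rowComponent_X_pow_mul [NeZero n] (l : Fin n → ℕ) (N : ℕ)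
    (f : MvPolynomial (Fin n × Fin n) K) :
    rowComponent K (l + Pi.single 0 N) (X (0, 0) ^ N * f) = X (0, 0) ^ N * rowComponent K l f := by
  ext m
  rw [coeff_rowComponent, X_pow_eq_monomial, coeff_monomial_mul', coeff_monomial_mul',
    coeff_rowComponent]
  by_cases hs : Finsupp.single ((0 : Fin n), (0 : Fin n)) N ≤ m
  · rw [if_pos hs, if_pos hs, one_mul, one_mul]
    obtain ⟨d, rfl⟩ := exists_add_of_le hs
    rw [add_tsub_cancel_left]
    congr 1
    rw [eq_iff_iff]
    refine forall_congr' fun i => ?_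
    by_cases hi : i = 0
    · subst hi
      simp only [Finsupp.add_apply, Finset.sum_add_distrib, Pi.add_apply, Pi.single_eq_same]
      rw [Finset.sum_eq_single (0 : Fin n) (fun b _ hb => by simp [hb.symm]) (by simp),
        Finsupp.single_eq_same]
      omega
    · have : ∀ j, Finsupp.single ((0 : Fin n), (0 : Fin n)) N (i, j) = 0 := fun j => by
        simp [Ne.symm hi]
      simp [this, hi]
  · rw [if_neg hs, if_neg hs, ite_self]

/-- A term of a minor takes one entry from each chosen row, and a minor with a repeated row is zero.
-/
theorem columnMinorSpan_le_weightLE [NeZero n] (J : Finset (Fin n)) :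
    columnMinorSpan K J ≤ weightLE K (firstRowWeight n) 1 := by
  classical
  refine Submodule.span_le.2 ?_
  rintro _ ⟨I, rfl⟩
  beta_reduce
  by_cases hI : Function.Injective I
  · rw [SetLike.mem_coe, Matrix.det_apply]
    refine Submodule.sum_mem _ fun s _ => ?_
    have hprod : (∏ b : J, Matrix.of (fun a b : J =>
        (X (I a, (b : Fin n)) : MvPolynomial (Fin n × Fin n) K)) (s b) b) ∈
        weightLE K (firstRowWeight n) 1 := by
      refine weightLE_mono _ ?_ (prod_mem_weightLE _ _
        (fun b : J => firstRowWeight n (I (s b), (b : Fin n))) fun b _ => X_mem_weightLE le_rfl)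
      simp only [firstRowWeight]
      rw [Finset.sum_boole]
      have : (Finset.univ.filter fun b : J => I (s b) = 0).card ≤ 1 :=
        Finset.card_le_one.2 fun a ha b hb => by
          simp only [Finset.mem_filter, Finset.mem_univ, true_and] at ha hb
          exact s.injective (hI (ha.trans hb.symm))
      exact_mod_cast this
    rcases Int.units_eq_one_or (Equiv.Perm.sign s) with h | h
    · rw [h, one_smul]
      exact hprod
    · rw [h, Units.neg_smul, one_smul]
      exact Submodule.neg_mem _ hprod
  · obtain ⟨a, b, hab, hne⟩ : ∃ a b, I a = I b ∧ a ≠ b := by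
      simpa [Function.Injective] using hI
    rw [SetLike.mem_coe, Matrix.det_zero_of_row_eq hne (by ext c; simp [hab])]
    exact Submodule.zero_mem _

theorem minorProductSpan_le_weightLE [NeZero n] (l : Fin n → ℕ) (N : ℕ) :
    minorProductSpan K l N ≤ weightLE K (firstRowWeight n) N := by
  induction N with
  | zero =>
    rw [minorProductSpan, Finset.range_zero, Finset.prod_empty, Submodule.one_le]
    exact_mod_cast one_mem_weightLE (R := K) (firstRowWeight n)
  | succ N ih =>
    rw [minorProductSpan, Finset.prod_range_succ, Submodule.mul_le]
    intro f hf g hg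
    exact mul_mem_weightLE (ih hf) (columnMinorSpan_le_weightLE _ hg) (by push_cast; rfl)

theorem columnMinorSpan_singleton (j : Fin n) :
    columnMinorSpan K {j} = Submodule.span K (Set.range fun i : Fin n => X (i, j)) := by
  rw [columnMinorSpan]
  congr 1
  ext f
  constructor
  · rintro ⟨I, rfl⟩
    refine ⟨I default, ?_⟩
    beta_reduce
    rw [Matrix.det_unique]
    rfl
  · rintro ⟨i, rfl⟩
    refine ⟨fun _ => i, ?_⟩
    beta_reduce
    rw [Matrix.det_unique]
    rfl

/-- The columns from a to a + b - 1 of the diagram consist of a single cell, in the first row. -/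
theorem minorProductSpan_add_eq [NeZero n] {l : Fin n → ℕ} {a b : ℕ} (ha : ∀ j ≠ 0, l j ≤ a)
    (hb : a + b ≤ l 0) :
    minorProductSpan K l (a + b) = minorProductSpan K l a * columnMinorSpan K {0} ^ b := by
  rw [minorProductSpan, Finset.prod_range_add]
  congr 1
  rw [Finset.prod_congr rfl (g := fun _ => columnMinorSpan K {0}) fun c hc => ?_,
    Finset.prod_const, Finset.card_range]
  congr 1
  ext j
  simp only [Finset.mem_filter, Finset.mem_univ, true_and, Finset.mem_singleton]
  rw [Finset.mem_range] at hc
  constructor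
  · intro h
    by_contra hj
    have := ha j hj
    omega
  · rintro rfl
    omega

/-- A polynomial of degree `k` in the first column is, up to polynomials of degree less than `N`
in the first row, divisible by the `N`-th power of the corner entry. -/
theorem exists_sub_X_pow_mul_mem [NeZero n] (k N : ℕ) (hN : N ≤ k)
    {f : MvPolynomial (Fin n × Fin n) K} (hf : f ∈ columnMinorSpan K {0} ^ k) :
    ∃ g ∈ columnMinorSpan K {(0 : Fin n)} ^ (k - N),
      f - X (0, 0) ^ N * g ∈ weightLE K (firstRowWeight n) ((N : ℤ) - 1) := by
  induction k generalizing N f with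
  | zero =>
    obtain rfl : N = 0 := by omega
    exact ⟨f, hf, by simp⟩
  | succ k ih =>
    rcases N with _ | N
    · exact ⟨f, hf, by simp⟩
    have hX : ∀ i : Fin n, (X (i, 0) : MvPolynomial (Fin n × Fin n) K) ∈ columnMinorSpan K {0} := by
      intro i
      rw [columnMinorSpan_singleton]
      exact Submodule.subset_span ⟨i, rfl⟩
    rw [pow_succ] at hf
    induction hf using Submodule.mul_induction_on' with
    | mem_mul_mem f hf g hg =>
      rw [columnMinorSpan_singleton] at hg
      induction hg using Submodule.span_induction with
      | mem g hg =>
        obtain ⟨i, rfl⟩ := hg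
        by_cases hi : i = 0
        · subst hi
          obtain ⟨g, hg, h⟩ := ih N (by omega) hf
          refine ⟨g, by rwa [Nat.add_sub_add_right], ?_⟩
          have e : f * X (0, 0) - X (0, 0) ^ (N + 1) * g =
              (f - X (0, 0) ^ N * g) * X (0, 0) := by ring
          rw [e]
          exact mul_mem_weightLE h (X_mem_weightLE (k := 1) (by simp [firstRowWeight]))
            (by push_cast; omega)
        · have hXi : (X (i, 0) : MvPolynomial (Fin n × Fin n) K) ∈
              weightLE K (firstRowWeight n) 0 := X_mem_weightLE (by simp [firstRowWeight, hi])
          by_cases hk : N + 1 ≤ k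
          · obtain ⟨g, hg, h⟩ := ih (N + 1) hk hf
            refine ⟨g * X (i, 0), ?_, ?_⟩
            · rw [show k + 1 - (N + 1) = k - (N + 1) + 1 by omega, pow_succ]
              exact Submodule.mul_mem_mul hg (hX i)
            · have e : f * X (i, 0) - X (0, 0) ^ (N + 1) * (g * X (i, 0)) =
                  (f - X (0, 0) ^ (N + 1) * g) * X (i, 0) := by ring
              rw [e]
              exact mul_mem_weightLE h hXi (by omega)
          · obtain rfl : N = k := by omega
            -- All N + 1 factors would have to be x (0, 0), but one is not. The whole product
            -- already has first-row degree at most N.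
            refine ⟨0, Submodule.zero_mem _, ?_⟩
            rw [mul_zero, sub_zero]
            have hle : columnMinorSpan K {(0 : Fin n)} ^ N ≤
                weightLE K (firstRowWeight n) N := by
              have h := minorProductSpan_le_weightLE (K := K) (n := n)
                (fun j => if j = 0 then N else 0) N
              have h2 := minorProductSpan_add_eq (K := K) (n := n)
                (l := fun j => if j = 0 then N else 0) (a := 0) (b := N) (by simp +contextual)
                (by simp)
              rw [zero_add] at h2
              rw [h2, minorProductSpan, Finset.range_zero, Finset.prod_empty, one_mul] at h
              exact h
            exact mul_mem_weightLE (hle hf) hXi (by push_cast; omega)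
      | zero => exact ⟨0, Submodule.zero_mem _, by simp⟩
      | add g g' _ _ h h' =>
        obtain ⟨u, hu, h⟩ := h
        obtain ⟨u', hu', h'⟩ := h'
        refine ⟨u + u', Submodule.add_mem _ hu hu', ?_⟩
        convert Submodule.add_mem _ h h' using 1
        ring
      | smul c g _ h =>
        obtain ⟨u, hu, h⟩ := h
        refine ⟨c • u, Submodule.smul_mem _ c hu, ?_⟩
        convert Submodule.smul_mem _ c h using 1
        rw [smul_sub, mul_smul_comm, mul_smul_comm]
    | add f _ f' _ h h' =>
      obtain ⟨u, hu, h⟩ := h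
      obtain ⟨u', hu', h'⟩ := h'
      refine ⟨u + u', Submodule.add_mem _ hu hu', ?_⟩
      convert Submodule.add_mem _ h h' using 1
      ring

namespace BoundedPartition

theorem part_zero [NeZero n] (m : BoundedPartition n r) : m.part 0 = m.parts 0 := by
  rw [part, dif_pos (NeZero.pos n)]
  rfl

theorem parts_le_part_zero [NeZero n] (m : BoundedPartition n r) (j : Fin n) :
    m.parts j ≤ m.parts 0 := m.antitone' (Fin.zero_le j)

theorem parts_le_part_one [NeZero n] (m : BoundedPartition n r) {j : Fin n} (hj : j ≠ 0) :
    m.parts j ≤ m.part 1 := by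
  have h0 : (j : ℕ) ≠ 0 := fun h => hj (Fin.ext h)
  rw [part, dif_pos (by omega)]
  exact m.antitone' (Fin.le_def.2 (by simp only []; omega))

theorem part_one_le [NeZero n] (m : BoundedPartition n r) : m.part 1 ≤ m.parts 0 := by
  rw [part]
  split_ifs
  · exact m.parts_le_part_zero _
  · exact Nat.zero_le _

theorem addFirst_parts [NeZero n] (m : BoundedPartition n r) (N : ℕ) :
    (m.addFirst N).parts = m.parts + Pi.single 0 N := rfl

end BoundedPartition

variable [NeZero n]

theorem columnInvariants_eq_mul [Infinite K] (m : BoundedPartition n r) :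
    columnInvariants K m.parts =
      minorProductSpan K m.parts (m.part 1) *
        columnMinorSpan K {0} ^ (m.parts 0 - m.part 1) := by
  have h := m.part_one_le
  rw [columnInvariants_eq_minorProductSpan m m.parts_le_part_zero,
    ← minorProductSpan_add_eq (fun j hj => m.parts_le_part_one hj) (by omega)]
  congr 1
  omega

/-- Lengthening the first row leaves the columns c < `m.part 1` unchanged and only adds columns with
one cell. -/
theorem columnInvariants_addFirst_eq_mul [Infinite K] (m : BoundedPartition n r) (N : ℕ) :
    columnInvariants K (m.addFirst N).parts =
      minorProductSpan K m.parts (m.part 1) *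
        columnMinorSpan K {0} ^ (m.parts 0 - m.part 1 + N) := by
  have h := m.part_one_le
  have h0 : (m.addFirst N).parts 0 = m.parts 0 + N := by simp [m.addFirst_parts]
  have hj : ∀ j ≠ 0, (m.addFirst N).parts j = m.parts j := fun j hj => by
    simp [m.addFirst_parts, hj]
  rw [columnInvariants_eq_minorProductSpan _ (m.addFirst N).parts_le_part_zero, h0,
    show m.parts 0 + N = m.part 1 + (m.parts 0 - m.part 1 + N) by omega,
    minorProductSpan_add_eq (fun j hj' => (hj j hj').trans_le (m.parts_le_part_one hj'))
      (by omega)]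
  congr 1
  refine Finset.prod_congr rfl fun c hc => ?_
  congr 1
  ext j
  rw [Finset.mem_range] at hc
  simp only [Finset.mem_filter, Finset.mem_univ, true_and]
  by_cases hj' : j = 0
  · subst hj'
    omega
  · rw [hj j hj']

theorem X_pow_mul_mem_columnInvariants [Infinite K] (m : BoundedPartition n r) (N : ℕ)
    {f : MvPolynomial (Fin n × Fin n) K} (hf : f ∈ columnInvariants K m.parts) :
    X (0, 0) ^ N * f ∈ columnInvariants K (m.addFirst N).parts := by
  have hX : (X (0, 0) : MvPolynomial (Fin n × Fin n) K) ∈ columnMinorSpan K {0} := by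
    rw [columnMinorSpan_singleton]
    exact Submodule.subset_span ⟨0, rfl⟩
  rw [columnInvariants_eq_mul] at hf
  rw [columnInvariants_addFirst_eq_mul, pow_add, ← mul_assoc,
    mul_comm (X (0, 0) ^ N)]
  exact Submodule.mul_mem_mul hf (Submodule.pow_mem_pow _ hX N)

theorem exists_sub_X_pow_mul_mem_of_columnInvariants [Infinite K] (m : BoundedPartition n r)
    (N : ℕ) {f : MvPolynomial (Fin n × Fin n) K}
    (hf : f ∈ columnInvariants K (m.addFirst N).parts) :
    ∃ g ∈ columnInvariants K m.parts,
      f - X (0, 0) ^ N * g ∈ weightLE K (firstRowWeight n) ((N : ℤ) - 1 + m.part 1) := by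
  rw [columnInvariants_addFirst_eq_mul] at hf
  rw [columnInvariants_eq_mul]
  induction hf using Submodule.mul_induction_on' with
  | mem_mul_mem u hu v hv =>
    obtain ⟨g, hg, h⟩ := exists_sub_X_pow_mul_mem _ N (by omega) hv
    rw [Nat.add_sub_cancel] at hg
    refine ⟨u * g, Submodule.mul_mem_mul hu hg, ?_⟩
    have e : u * v - X (0, 0) ^ N * (u * g) = (v - X (0, 0) ^ N * g) * u := by ring
    rw [e]
    exact mul_mem_weightLE h (minorProductSpan_le_weightLE _ _ hu) le_rfl
  | add f _ f' _ h h' =>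
    obtain ⟨u, hu, h⟩ := h
    obtain ⟨u', hu', h'⟩ := h'
    refine ⟨u + u', Submodule.add_mem _ hu hu', ?_⟩
    convert Submodule.add_mem _ h h' using 1
    ring

theorem columnInvariants_le_weightLE [Infinite K] (m : BoundedPartition n r) :
    columnInvariants K m.parts ≤ weightLE K (firstRowWeight n) (m.parts 0) := by
  rw [columnInvariants_eq_minorProductSpan m m.parts_le_part_zero]
  exact minorProductSpan_le_weightLE _ _

/-- The row being added is never the first one, so no degree in the first row is gained. -/
theorem rowShear_mem_weightLE {i i' : Fin n} (hi : (i' : ℕ) = i + 1) {k : ℤ}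
    {f : MvPolynomial (Fin n × Fin n) K} (hf : f ∈ weightLE K (firstRowWeight n) k) :
    rowShear K i i' f ∈ weightLE K (firstRowWeight n) k := by
  have hi' : i' ≠ 0 := by
    rintro rfl
    simp at hi
  refine aeval_mem_weightLE (u := firstRowWeight n) _ (fun v => ?_) hf
  split_ifs
  · refine Submodule.add_mem _ (X_mem_weightLE le_rfl) (X_mem_weightLE ?_)
    simp only [firstRowWeight, hi', if_false]
    split_ifs <;> simp
  · exact X_mem_weightLE le_rfl

/-- Up to terms of other row degrees, adding a row to the preceding one commutes with the
multiplication by a power of the corner entry. -/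
theorem rowComponent_rowShear_X_pow_mul [Infinite K] (p : ℕ) (hp : 0 < p) [CharP K p]
    (l m : BoundedPartition n r) (k d : ℕ)
    (hd : min (l.part 1 : ℤ) ((m.part 0 : ℤ) - (l.part 0 : ℤ)) < (p : ℤ) ^ d)
    {i i' : Fin n} (hi : (i' : ℕ) = i + 1) {f : MvPolynomial (Fin n × Fin n) K}
    (hf : f ∈ columnInvariants K m.parts) :
    rowComponent K (l.addFirst (k * p ^ d)).parts (rowShear K i i' (X (0, 0) ^ (k * p ^ d) * f)) =
      X (0, 0) ^ (k * p ^ d) * rowComponent K l.parts (rowShear K i i' f) := by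
  have hprime : Fact p.Prime := ⟨(CharP.char_is_prime_or_zero K p).resolve_right hp.ne'⟩
  have hi' : i' ≠ 0 := by
    rintro rfl
    simp at hi
  rw [map_mul, ← rowComponent_X_pow_mul, ← l.addFirst_parts]
  by_cases hi0 : i = 0
  · subst hi0
    have hX : rowShear K 0 i' (X (0, 0)) = X (0, 0) + X (i', 0) := by simp [rowShear]
    have hw : ∀ a : Fin n, (X (a, 0) : MvPolynomial (Fin n × Fin n) K) ^ p ^ d ∈
        weightLE K (firstRowWeight n) ((p ^ d : ℕ) : ℤ) := by
      intro a
      refine weightLE_mono _ ?_ (pow_mem_weightLE (X_mem_weightLE (k := 1) ?_) _)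
      · simp
      · simp only [firstRowWeight]
        split_ifs <;> simp
    obtain ⟨c, hc, h⟩ := exists_add_pow_eq_add_mul (hw 0) (hw i') k
    rw [map_pow, hX, mul_comm k, pow_mul, add_pow_char_pow, h, add_mul, map_add, pow_mul,
      add_eq_left]
    -- The error term is a multiple of x (i', 0)^(p^d). Under the first alternative its degree in
    -- row i' is too large; under the second, its degree in the first row is too small.
    rcases min_lt_iff.1 hd with hd | hd
    · ext e
      rw [coeff_rowComponent, coeff_zero]
      split_ifs with he
      · rw [mul_assoc, X_pow_eq_monomial, coeff_monomial_mul', if_neg]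
        intro hle
        have h1 := hle (i', 0)
        rw [Finsupp.single_eq_same] at h1
        have h2 := he i'
        have h3 : e (i', 0) ≤ ∑ j, e (i', j) :=
          Finset.single_le_sum (fun j _ => Nat.zero_le (e (i', j))) (Finset.mem_univ (0 : Fin n))
        rw [l.addFirst_parts, Pi.add_apply, Pi.single_eq_of_ne hi'] at h2
        have h4 := l.parts_le_part_one hi'
        have h5 : l.part 1 < p ^ d := by exact_mod_cast hd
        omega
      · rfl
    · refine rowComponent_eq_zero (k := k * (p ^ d : ℕ) - (p ^ d : ℕ) + m.parts 0) ?_ ?_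
      · rw [m.part_zero, l.part_zero] at hd
        rw [l.addFirst_parts, Pi.add_apply, Pi.single_eq_same]
        push_cast
        linarith [mul_comm (k : ℤ) ((p : ℤ) ^ d)]
      · refine mul_mem_weightLE (k := k * (p ^ d : ℕ) - (p ^ d : ℕ)) (mul_mem_weightLE (k := 0)
          ?_ hc (by omega)) (rowShear_mem_weightLE hi (columnInvariants_le_weightLE m hf)) le_rfl
        refine weightLE_mono _ ?_ (pow_mem_weightLE (X_mem_weightLE (k := 0) ?_) _)
        · simp
        · simp [firstRowWeight, hi']
  · have hX : rowShear K i i' (X (0, 0)) = X (0, 0) := by simp [rowShear, Ne.symm hi0]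
    rw [map_pow, hX]

end AddFirst

/-! ### Multiplication by a power of the corner entry as an isomorphism -/

section Stability

variable {K : Type*} [Field K] {n r : ℕ}

theorem weylHomForms_apply_rowComponent [Infinite K] (m : BoundedPartition n r) {l : Fin n → ℕ}
    {θ : Module.Dual K (columnInvariants K m.parts)} (hθ : θ ∈ weylHomForms K l m.parts)
    {f g : columnInvariants K m.parts} (h : rowComponent K l f.1 = rowComponent K l g.1) :
    θ f = θ g := by
  rw [← hθ.1 f ⟨_, rowComponent_mem_columnInvariants m l f.2⟩ rfl,
    ← hθ.1 g ⟨_, rowComponent_mem_columnInvariants m l g.2⟩ rfl]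
  congr 1
  exact Subtype.ext h

variable [NeZero n]

/-- The division by a power of the corner entry, applied to a component of given row degrees. -/
def divComponent (K : Type*) [Field K] {n : ℕ} [NeZero n] (l : Fin n → ℕ) (N : ℕ) :
    MvPolynomial (Fin n × Fin n) K →ₗ[K] MvPolynomial (Fin n × Fin n) K where
  toFun f := (rowComponent K l f).divMonomial (Finsupp.single (0, 0) N)
  map_add' f g := by rw [map_add, add_divMonomial]
  map_smul' c f := by
    ext m
    simp [coeff_divMonomial]

/-- The error has first-row degree at most N - 1 + μ₂, below N + λ₁ because μ₂ ≤ λ₁, so it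
disappears in row degrees λ⁺ and the division is exact. -/
theorem divComponent_X_pow_mul_add (l m : BoundedPartition n r) (N : ℕ)
    (hml : m.part 1 ≤ l.part 0) (f g : MvPolynomial (Fin n × Fin n) K)
    (h : f - X (0, 0) ^ N * g ∈ weightLE K (firstRowWeight n) ((N : ℤ) - 1 + m.part 1)) :
    divComponent K (l.addFirst N).parts N f = rowComponent K l.parts g := by
  have hz : rowComponent K (l.addFirst N).parts (f - X (0, 0) ^ N * g) = 0 := by
    refine rowComponent_eq_zero ?_ h
    rw [l.part_zero] at hml
    rw [l.addFirst_parts, Pi.add_apply, Pi.single_eq_same]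
    push_cast
    omega
  rw [map_sub, sub_eq_zero, l.addFirst_parts, rowComponent_X_pow_mul] at hz
  change (rowComponent K (l.addFirst N).parts f).divMonomial _ = _
  rw [l.addFirst_parts, hz, X_pow_eq_monomial, divMonomial_monomial_mul]

theorem divComponent_mem [Infinite K] (l m : BoundedPartition n r) (N : ℕ)
    (hml : m.part 1 ≤ l.part 0) (f : MvPolynomial (Fin n × Fin n) K)
    (hf : f ∈ columnInvariants K (m.addFirst N).parts) :
    divComponent K (l.addFirst N).parts N f ∈ columnInvariants K m.parts := by
  obtain ⟨g, hg, h⟩ := exists_sub_X_pow_mul_mem_of_columnInvariants m N hf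
  rw [divComponent_X_pow_mul_add l m N hml f g h]
  exact rowComponent_mem_columnInvariants m _ hg

/-- The multiplication by a power of the corner entry, on invariants of column operations. -/
def mulXPow (K : Type*) [Field K] [Infinite K] (m : BoundedPartition n r) (N : ℕ) :
    columnInvariants K m.parts →ₗ[K] columnInvariants K (m.addFirst N).parts :=
  (LinearMap.mulLeft K (X (0, 0) ^ N)).restrict fun _ hf => X_pow_mul_mem_columnInvariants m N hf

theorem mulXPow_coe [Infinite K] (m : BoundedPartition n r) (N : ℕ)
    (f : columnInvariants K m.parts) : (mulXPow K m N f).1 = X (0, 0) ^ N * f.1 := rfl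

theorem rank_weylHomForms_addFirst [Infinite K] (p : ℕ) (hp : 0 < p) [CharP K p]
    (l m : BoundedPartition n r) (hml : m.part 1 ≤ l.part 0) (k d : ℕ)
    (hd : min (l.part 1 : ℤ) ((m.part 0 : ℤ) - (l.part 0 : ℤ)) < (p : ℤ) ^ d) :
    Module.rank K (weylHomForms K l.parts m.parts) =
      Module.rank K (weylHomForms K (l.addFirst (k * p ^ d)).parts
        (m.addFirst (k * p ^ d)).parts) := by
  have hcomm : ∀ {i i' : Fin n}, (i' : ℕ) = i + 1 → ∀ f ∈ columnInvariants K m.parts,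
      rowComponent K (l.addFirst (k * p ^ d)).parts
        (rowShear K i i' (X (0, 0) ^ (k * p ^ d) * f)) =
      X (0, 0) ^ (k * p ^ d) * rowComponent K l.parts (rowShear K i i' f) :=
    fun hi f hf => rowComponent_rowShear_X_pow_mul p hp l m k d hd hi hf
  -- From here on, the form of N matters only through `hcomm`.
  generalize k * p ^ d = N at hcomm ⊢
  have hmaps : ∀ θ ∈ weylHomForms K (l.addFirst N).parts (m.addFirst N).parts,
      (mulXPow K m N).dualMap θ ∈ weylHomForms K l.parts m.parts := by
    intro θ hθ
    refine ⟨fun f g hg => ?_, fun i i' hi f g hg => ?_⟩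
    · refine hθ.1 _ _ ?_
      rw [mulXPow_coe, mulXPow_coe, l.addFirst_parts, rowComponent_X_pow_mul, hg]
    · refine Eq.trans (weylHomForms_apply_rowComponent _ hθ ?_)
        (hθ.2 i i' hi (mulXPow K m N f)
          ⟨_, rowShear_mem_columnInvariants _ i i' (mulXPow K m N f).2⟩ rfl)
      change rowComponent K _ (X (0, 0) ^ N * g.1) =
        rowComponent K _ (rowShear K i i' (X (0, 0) ^ N * f.1))
      rw [hcomm hi f.1 f.2, hg, l.addFirst_parts, rowComponent_X_pow_mul]
  refine (LinearEquiv.ofBijective ((mulXPow K m N).dualMap.restrict hmaps) ⟨?_, ?_⟩).rank_eq.symm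
  · rw [injective_iff_map_eq_zero]
    rintro ⟨θ, hθ⟩ h
    refine Subtype.ext (LinearMap.ext fun f => ?_)
    -- A form in `weylHomForms` sees only row degrees λ⁺, where f agrees with a multiple of x (0,
    -- 0)^N.
    obtain ⟨g, hg, hfg⟩ := exists_sub_X_pow_mul_mem_of_columnInvariants m N f.2
    have h0 : θ (mulXPow K m N ⟨g, hg⟩) = 0 :=
      LinearMap.congr_fun (congrArg Subtype.val h) ⟨g, hg⟩
    refine Eq.trans (weylHomForms_apply_rowComponent _ hθ ?_) h0
    rw [mulXPow_coe, ← sub_eq_zero, ← map_sub]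
    refine rowComponent_eq_zero ?_ hfg
    rw [l.part_zero] at hml
    rw [l.addFirst_parts, Pi.add_apply, Pi.single_eq_same]
    push_cast
    omega
  · rintro ⟨θ, hθ⟩
    -- The preimage of θ projects to row degrees λ⁺, divides by x (0, 0)^N and then applies θ.
    let θ' : Module.Dual K (columnInvariants K (m.addFirst N).parts) :=
      θ ∘ₗ (divComponent K (l.addFirst N).parts N).restrict (divComponent_mem l m N hml)
    have hθ' : ∀ (f : columnInvariants K (m.addFirst N).parts) (g : columnInvariants K m.parts),
        divComponent K (l.addFirst N).parts N f.1 = rowComponent K l.parts g.1 → θ' f = θ g :=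
      fun f g h => hθ.1 g _ h
    have hmem : θ' ∈ weylHomForms K (l.addFirst N).parts (m.addFirst N).parts := by
      refine ⟨fun f g hg => ?_, fun i i' hi f g hg => ?_⟩
      · refine congrArg θ (Subtype.ext ?_)
        change (rowComponent K _ g.1).divMonomial _ = (rowComponent K _ f.1).divMonomial _
        congr 1
        rw [hg]
        ext e
        rw [coeff_rowComponent, coeff_rowComponent]
        split_ifs <;> rfl
      · obtain ⟨u, hu, hfu⟩ := exists_sub_X_pow_mul_mem_of_columnInvariants m N f.2
        rw [hθ' f ⟨u, hu⟩ (divComponent_X_pow_mul_add l m N hml _ _ hfu),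
          ← hθ.2 i i' hi ⟨u, hu⟩ ⟨_, rowShear_mem_columnInvariants m i i' hu⟩ rfl]
        refine hθ' _ _ ?_
        -- The row shear does not raise first-row degrees, so the error remains invisible after it.
        have hz : rowComponent K (l.addFirst N).parts
            (rowShear K i i' (f.1 - X (0, 0) ^ N * u)) = 0 := by
          refine rowComponent_eq_zero ?_ (rowShear_mem_weightLE hi hfu)
          rw [l.part_zero] at hml
          rw [l.addFirst_parts, Pi.add_apply, Pi.single_eq_same]
          push_cast
          omega
        rw [map_sub, map_sub, sub_eq_zero, hcomm hi u hu] at hz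
        change (rowComponent K _ g.1).divMonomial _ = _
        rw [hg, hz, X_pow_eq_monomial, divMonomial_monomial_mul]
    refine ⟨⟨θ', hmem⟩, Subtype.ext (LinearMap.ext fun g => ?_)⟩
    refine hθ' (mulXPow K m N g) g (divComponent_X_pow_mul_add l m N hml _ _ ?_)
    rw [mulXPow_coe, sub_self]
    exact Submodule.zero_mem _

end Stability

end

theorem theorem2p1 (K : Type*) [Field K] [Infinite K] (p : ℕ) (hp : 0 < p) [CharP K p]
    (n r : ℕ) [NeZero n] (lam mu : BoundedPartition n r) (hmu : mu.part 1 ≤ lam.part 0)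
    (k d : ℕ)
    (hd : min (lam.part 1 : ℤ) ((mu.part 0 : ℤ) - (lam.part 0 : ℤ)) < (p : ℤ) ^ d) :
    Module.rank K (WeylHom K lam mu) =
      Module.rank K (WeylHom K (lam.addFirst (k * p ^ d)) (mu.addFirst (k * p ^ d))) := by
  rw [rank_weylHom, rank_weylHom]
  exact rank_weylHomForms_addFirst p hp lam mu hmu k d hd
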